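/- Let $0<a<b$. There exist constants $C>0$ and $t_0>0$, depending only on $a$ and $b$, such that the following holds. Let $L>0$, let $u_0,u_1\in (C_0^\infty(\mathbf{R}^2))^2$ satisfy $\operatorname{supp}u_0\cup\operatorname{supp}u_1\subset\{|x|\le L\}$, and let $u:[0,\infty)\times\mathbf{R}^2\to\mathbf{R}^2$ be a smooth ($C^\infty$ up to $t=0$) solution of the undamped system of elastic waves $$u_{tt}-a^2\Delta u-(b^2-a^2)\nabla\operatorname{div}u=0\quad\text{in }(0,\infty)\times\mathbf{R}^2,\qquad u(0,x)=u_0(x),\quad u_t(0,x)=u_1(x)\quad(x\in\mathbf{R}^2).$$ Then for all $t\ge t_0$ one has $u(t,\cdot)\in (L^2(\mathbf{R}^2))^2$ and $$\int_{\mathbf{R}^2}|u(t,x)|^2\,dx\le C\left(\|u_0\|_{L^2}^2+\|u_1\|_{L^\infty}^2+\|u_1\|_{L^1}^2\log(2L+bt)\right),$$ where $|\cdot|$ is the Euclidean norm and the norms of the vector fields $u_0,u_1$ are the $L^p$ norms of $|u_0|,|u_1|$. In particular, $\int_{\mathbf{R}^2}|u(t,x)|^2\,dx=O(\log t)$ as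 $t\to\infty$. -/

import Mathlib

open Set MeasureTheory Asymptotics Filter
open scoped ContDiff Laplacian Gradient

/-- The Euclidean plane, with the norm `|x| = (x₁² + x₂²)^(1/2)`. -/
abbrev Plane : Type := EuclideanSpace ℝ (Fin 2)

/-- The divergence `∂₁ w₁ + ∂₂ w₂` of a vector field on the plane. -/
noncomputable def divergence (w : Plane → Plane) (x : Plane) : ℝ :=
  ∑ i : Fin 2, fderiv ℝ w x (EuclideanSpace.single i 1) i

/-- `u` is a smooth solution of the Cauchy problem for the undamped system of elastic waves
`u_tt - a² Δu - (b² - a²) ∇ div u = 0` in `(0, ∞) × ℝ²`, `u(0, ·) = u₀`, `u_t(0, ·) = u₁`.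
Only the values `u t x` with `0 ≤ t` matter; `u` is smooth up to the initial time. -/
structure IsSmoothElasticSolution (a b : ℝ) (u₀ u₁ : Plane → Plane)
    (u : ℝ → Plane → Plane) : Prop where
  smooth : ContDiffOn ℝ ∞ (fun p : ℝ × Plane => u p.1 p.2) (Ici 0 ×ˢ univ)
  equation : ∀ t : ℝ, 0 < t → ∀ x : Plane,
    iteratedDeriv 2 (fun s => u s x) t - a ^ 2 • Δ (u t) x
      - (b ^ 2 - a ^ 2) • ∇ (divergence (u t)) x = 0
  initial_value : ∀ x : Plane, u 0 x = u₀ x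
  initial_velocity : ∀ x : Plane, HasDerivWithinAt (fun s => u s x) (u₁ x) (Ici 0) 0

/-! The natural energy of $u$ controls $u_t$ and $\nabla u$, not $u$ itself. The proof therefore
works with the time primitive $v(t,x)=\int_0^t u(s,x)\,ds$, whose velocity is $u$. Integrating the
system once in time gives $v_{tt}=a^2\Delta v+(b^2-a^2)\nabla\operatorname{div}v+u_1$ with $v(0)=0$
and $v_t(0)=u_0$. The source does not depend on time, so its power $u_1\cdot v_t$ is the time
derivative of $u_1\cdot v$, and the energy of $v$ minus $\int u_1\cdot v$ is conserved
(`integral_correctedEnergy_eq`). Hence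
$\frac12\|u\|_2^2+\frac{a^2}{2}\|Dv\|_2^2\le\frac12\|u_0\|_2^2+\int|u_1||v|$ (`energy_inequality`).

It remains to absorb the last integral into $\|Dv\|_2^2$. In the plane $\|Dv\|_2$ does not bound
$\|v\|_\infty$, but it nearly does for functions with bounded support, at the price of the square
root of a logarithm. By finite speed of propagation (`eq_zero_of_lt_norm`) $v(t)$ vanishes where
$|x|>L+bt$. Averaging the fundamental theorem of calculus over all rays from $y$ gives
$2\pi|v(y)|\le\int|z|^{-1}|Dv(y+z)|\,dz$ (`two_pi_mul_enorm_le`). For $|z|<1$ the kernel is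
integrable, which costs $\|u_1\|_2$; for $1\le|z|\le 2L+bt$ its $L^2$ norm is
$\sqrt{2\pi\log(2L+bt)}$, which costs $\|u_1\|_1$ (`lintegral_enorm_mul_enorm_le`). Young's
inequality then removes $\|Dv\|_2$, and $\|u_1\|_2^2\le\|u_1\|_\infty\|u_1\|_1$ leaves the norms of
the theorem. -/

open Function Topology

/-! ### Calculus of time primitives. -/

section TimeIntegral

variable {X F : Type*} [NormedAddCommGroup X] [NormedSpace ℝ X] [ProperSpace X]
  [NormedAddCommGroup F] [NormedSpace ℝ F]

/-- Differentiation under the integral sign for jointly continuous data. -/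
lemma hasFDerivAt_intervalIntegral_of_continuous (f : ℝ → X → F) (f' : ℝ → X → X →L[ℝ] F)
    (hf : Continuous (uncurry f)) (hf' : Continuous (uncurry f'))
    (h : ∀ s x, HasFDerivAt (f s) (f' s x) x) (c t : ℝ) (x : X) :
    HasFDerivAt (fun y => ∫ s in c..t, f s y) (∫ s in c..t, f' s x) x := by
  obtain ⟨M, hM⟩ := ((isCompact_uIcc (a := c) (b := t)).prod
    (isCompact_closedBall x 1)).exists_bound_of_continuousOn hf'.continuousOn
  have hfx : ∀ y, Continuous fun s => f s y := fun y =>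
    hf.comp (continuous_id.prodMk continuous_const)
  have hfx' : ∀ y, Continuous fun s => f' s y := fun y =>
    hf'.comp (continuous_id.prodMk continuous_const)
  refine intervalIntegral.hasFDerivAt_integral_of_dominated_of_fderiv_le
    (F := fun y s => f s y) (F' := fun y s => f' s y) (bound := fun _ => M)
    (Metric.closedBall_mem_nhds x one_pos)
    (Eventually.of_forall fun y => (hfx y).aestronglyMeasurable)
    ((hfx x).intervalIntegrable _ _) (hfx' x).aestronglyMeasurable
    (Eventually.of_forall fun s hs y hy => ?_) intervalIntegrable_const
    (Eventually.of_forall fun s _ y _ => h s y)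
  exact hM (s, y) ⟨uIoc_subset_uIcc hs, hy⟩

omit [NormedSpace ℝ X] [ProperSpace X] in
lemma continuous_uncurry_intervalIntegral (f : ℝ → X → F) (hf : Continuous (uncurry f)) (c : ℝ) :
    Continuous (uncurry fun t x => ∫ s in c..t, f s x) := by
  have : Continuous (uncurry fun (p : ℝ × X) (s : ℝ) => f s p.2) :=
    hf.comp (continuous_snd.prodMk (continuous_snd.comp continuous_fst))
  exact intervalIntegral.continuous_parametric_intervalIntegral_of_continuous this continuous_fst

omit [NormedSpace ℝ X] [ProperSpace X] in
lemma hasDerivAt_intervalIntegral_of_continuous [CompleteSpace F] (f : ℝ → X → F)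
    (hf : Continuous (uncurry f)) (c t : ℝ) (x : X) :
    HasDerivAt (fun r => ∫ s in c..r, f s x) (f t x) t := by
  have hfx : Continuous fun s => f s x := hf.comp (continuous_id.prodMk continuous_const)
  exact intervalIntegral.integral_hasDerivAt_right (hfx.intervalIntegrable _ _)
    (hfx.stronglyMeasurableAtFilter _ _) hfx.continuousAt

end TimeIntegral

/-! ### Smoothness up to the initial time. -/

section HalfSpace

variable {X F : Type*} [NormedAddCommGroup X] [NormedSpace ℝ X]
  [NormedAddCommGroup F] [NormedSpace ℝ F]

/-- The derivative in the space variable of a function on the half space `[0, ∞) × X`. -/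
noncomputable def spaceDeriv (f : ℝ × X → F) (p : ℝ × X) : X →L[ℝ] F :=
  (fderivWithin ℝ f (Ici (0 : ℝ) ×ˢ (univ : Set X)) p).comp (ContinuousLinearMap.inr ℝ ℝ X)

lemma uniqueDiffOn_halfSpace : UniqueDiffOn ℝ (Ici (0 : ℝ) ×ˢ (univ : Set X)) :=
  (uniqueDiffOn_Ici 0).prod uniqueDiffOn_univ

lemma contDiffOn_spaceDeriv {f : ℝ × X → F} (hf : ContDiffOn ℝ ∞ f (Ici (0 : ℝ) ×ˢ univ)) :
    ContDiffOn ℝ ∞ (spaceDeriv f) (Ici (0 : ℝ) ×ˢ univ) := by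
  have := hf.fderivWithin uniqueDiffOn_halfSpace (m := ∞) (by simp)
  exact this.clm_comp contDiffOn_const

lemma hasFDerivAt_spaceDeriv {f : ℝ × X → F} (hf : ContDiffOn ℝ ∞ f (Ici (0 : ℝ) ×ˢ univ))
    {t : ℝ} (ht : 0 ≤ t) (x : X) : HasFDerivAt (fun y => f (t, y)) (spaceDeriv f (t, x)) x := by
  have hd := (hf.differentiableOn (by simp) (t, x) ⟨ht, mem_univ _⟩).hasFDerivWithinAt
  have := hd.comp (x := x) (s := univ) (f := fun y : X => (t, y))
    (hasFDerivAt_prodMk_right t x).hasFDerivWithinAt (fun y _ => ⟨ht, mem_univ _⟩)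
  exact hasFDerivWithinAt_univ.1 this

/-- Freezing the function at its initial value for negative times makes it continuous on the whole
line. Time primitives are then differentiable at every time, including $0$. -/
lemma continuous_clamp {f : ℝ × X → F} (hf : ContDiffOn ℝ ∞ f (Ici (0 : ℝ) ×ˢ univ)) :
    Continuous (uncurry fun t x => f (max t 0, x)) := by
  refine hf.continuousOn.comp_continuous
    (f := fun p : ℝ × X => (max p.1 0, p.2)) (by fun_prop) fun p => ⟨le_max_right p.1 0, mem_univ _⟩

end HalfSpace

/-! ### The elastic operator and the equation integrated in time. -/

/-- The `i`-th standard basis vector of the plane. -/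
noncomputable abbrev basisVec (i : Fin 2) : Plane := EuclideanSpace.single i (1 : ℝ)

/-- The coordinates of `a² Δ + (b² - a²) ∇ div`, applied to a vector field with second
derivative `T`. -/
noncomputable def elasticOp (a b : ℝ) (T : Plane →L[ℝ] Plane →L[ℝ] Plane) (k : Fin 2) : ℝ :=
  a ^ 2 * ∑ j, T (basisVec j) (basisVec j) k
    + (b ^ 2 - a ^ 2) * ∑ j, T (basisVec k) (basisVec j) j

/-- A time primitive `v` of an elastic wave `w`, with the space derivatives
`G = Dv`, `H = D²v` and `w' = Dw`. -/
structure IsElasticPotential (a b : ℝ) (u₀ u₁ : Plane → Plane) (v w : ℝ → Plane → Plane)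
    (G w' : ℝ → Plane → Plane →L[ℝ] Plane)
    (H : ℝ → Plane → Plane →L[ℝ] Plane →L[ℝ] Plane) : Prop where
  continuous_v : Continuous (uncurry v)
  continuous_w : Continuous (uncurry w)
  continuous_G : Continuous (uncurry G)
  continuous_w' : Continuous (uncurry w')
  continuous_H : Continuous (uncurry H)
  hasFDerivAt_w : ∀ t x, HasFDerivAt (w t) (w' t x) x
  hasFDerivAt_v : ∀ t x, HasFDerivAt (v t) (G t x) x
  hasFDerivAt_G : ∀ t x, HasFDerivAt (G t) (H t x) x
  hasDerivAt_v : ∀ t x, HasDerivAt (fun s => v s x) (w t x) t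
  hasDerivAt_G : ∀ t x, HasDerivAt (fun s => G s x) (w' t x) t
  hasDerivAt_w : ∀ t, 0 < t → ∀ x k,
    HasDerivAt (fun s => w s x k) (u₁ x k + elasticOp a b (H t x) k) t
  w_zero : ∀ x, w 0 x = u₀ x
  v_zero : ∀ x, v 0 x = 0
  G_zero : ∀ x, G 0 x = 0

lemma spaceDeriv_clamp {F : Type*} [NormedAddCommGroup F] [NormedSpace ℝ F] {f : ℝ × Plane → F}
    (hf : ContDiffOn ℝ ∞ f (Ici (0 : ℝ) ×ˢ univ)) (t : ℝ) (x : Plane) :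
    HasFDerivAt (fun y => f (max t 0, y)) (spaceDeriv f (max t 0, x)) x :=
  hasFDerivAt_spaceDeriv hf (le_max_right _ _) x

lemma hasDerivAt_elasticOp (a b : ℝ) {T : ℝ → Plane →L[ℝ] Plane →L[ℝ] Plane}
    {T' : Plane →L[ℝ] Plane →L[ℝ] Plane} {t : ℝ} (h : HasDerivAt T T' t) (k : Fin 2) :
    HasDerivAt (fun s => elasticOp a b (T s) k) (elasticOp a b T' k) t := by
  have key : ∀ (x y : Plane) (i : Fin 2), HasDerivAt (fun s => T s x y i) (T' x y i) t := by
    intro x y i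
    have h1 : HasDerivAt (fun s => T s x y) (T' x y) t := by
      simpa using (h.clm_apply (hasDerivAt_const t x)).clm_apply (hasDerivAt_const t y)
    exact (EuclideanSpace.proj (𝕜 := ℝ) i).hasFDerivAt.comp_hasDerivAt t h1
  unfold elasticOp
  exact ((HasDerivAt.fun_sum fun j _ => key (basisVec j) (basisVec j) k).const_mul _).add
    ((HasDerivAt.fun_sum fun j _ => key (basisVec k) (basisVec j) j).const_mul _)

lemma continuous_elasticOp (a b : ℝ) (k : Fin 2) : Continuous fun T => elasticOp a b T k := by
  have key : ∀ (x y : Plane) (i : Fin 2),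
      Continuous fun T : Plane →L[ℝ] Plane →L[ℝ] Plane => T x y i := fun x y i =>
    (EuclideanSpace.proj (𝕜 := ℝ) i).continuous.comp
      ((ContinuousLinearMap.apply ℝ Plane y).continuous.comp
        (ContinuousLinearMap.apply ℝ (Plane →L[ℝ] Plane) x).continuous)
  unfold elasticOp
  exact (continuous_const.mul
    (continuous_finsetSum _ fun j _ => key (basisVec j) (basisVec j) k)).add
    (continuous_const.mul (continuous_finsetSum _ fun j _ => key (basisVec k) (basisVec j) j))

lemma laplacian_apply_of_hasFDerivAt {f : Plane → Plane} {f' : Plane → Plane →L[ℝ] Plane}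
    {f'' : Plane →L[ℝ] Plane →L[ℝ] Plane} {x : Plane} (hf : ∀ y, HasFDerivAt f (f' y) y)
    (hf' : HasFDerivAt f' f'' x) :
    Δ f x = ∑ j, f'' (basisVec j) (basisVec j) := by
  rw [InnerProductSpace.laplacian_eq_iteratedFDeriv_orthonormalBasis f
    (EuclideanSpace.basisFun (Fin 2) ℝ)]
  have h1 : fderiv ℝ f = f' := funext fun y => (hf y).fderiv
  simp [iteratedFDeriv_two_apply, h1, hf'.fderiv]

lemma gradient_divergence_apply {f : Plane → Plane} {f' : Plane → Plane →L[ℝ] Plane}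
    {f'' : Plane →L[ℝ] Plane →L[ℝ] Plane} {x : Plane} (hf : ∀ y, HasFDerivAt f (f' y) y)
    (hf' : HasFDerivAt f' f'' x) (k : Fin 2) :
    (∇ (divergence f) x) k = ∑ j, f'' (basisVec k) (basisVec j) j := by
  have h1 : divergence f = fun y => ∑ j, f' y (basisVec j) j := by
    funext y
    simp [divergence, (hf y).fderiv]
  have h2 : ∀ j : Fin 2, HasFDerivAt (fun y => f' y (basisVec j) j)
      ((EuclideanSpace.proj (𝕜 := ℝ) j).comp (f''.flip (basisVec j))) x := by
    intro j
    have h3 : HasFDerivAt (fun y => f' y (basisVec j)) (f''.flip (basisVec j)) x := by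
      simpa using hf'.clm_apply (hasFDerivAt_const (basisVec j) x)
    exact (EuclideanSpace.proj (𝕜 := ℝ) j).hasFDerivAt.comp x h3
  have h4 := HasFDerivAt.fun_sum (u := Finset.univ) fun j _ => h2 j
  have h5 : (∇ (divergence f) x) k = inner ℝ (∇ (divergence f) x) (basisVec k) := by
    rw [EuclideanSpace.inner_single_right]
    simp
  rw [h5, inner_gradient_left, h1, h4.fderiv]
  simp

/-- The time derivative of a function on the half space `[0, ∞) × X`. -/
noncomputable def timeDeriv {X F : Type*} [NormedAddCommGroup X] [NormedSpace ℝ X]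
    [NormedAddCommGroup F] [NormedSpace ℝ F] (f : ℝ × X → F) (p : ℝ × X) : F :=
  fderivWithin ℝ f (Ici (0 : ℝ) ×ˢ (univ : Set X)) p (1, 0)

section TimeDeriv

variable {X F : Type*} [NormedAddCommGroup X] [NormedSpace ℝ X]
  [NormedAddCommGroup F] [NormedSpace ℝ F] {f : ℝ × X → F}

lemma contDiffOn_timeDeriv (hf : ContDiffOn ℝ ∞ f (Ici (0 : ℝ) ×ˢ univ)) :
    ContDiffOn ℝ ∞ (timeDeriv f) (Ici (0 : ℝ) ×ˢ univ) :=
  (hf.fderivWithin uniqueDiffOn_halfSpace (m := ∞) (by simp)).clm_apply contDiffOn_const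

lemma hasDerivWithinAt_timeDeriv (hf : ContDiffOn ℝ ∞ f (Ici (0 : ℝ) ×ˢ univ))
    {t : ℝ} (ht : 0 ≤ t) (x : X) :
    HasDerivWithinAt (fun s => f (s, x)) (timeDeriv f (t, x)) (Ici 0) t := by
  have hd := (hf.differentiableOn (by simp) (t, x) ⟨ht, mem_univ _⟩).hasFDerivWithinAt
  have h1 : HasDerivWithinAt (fun s : ℝ => (s, x)) ((1 : ℝ), (0 : X)) (Ici 0) t :=
    ((hasDerivAt_id t).prodMk (hasDerivAt_const t x)).hasDerivWithinAt
  have h2 : MapsTo (fun s : ℝ => (s, x)) (Ici 0) (Ici (0 : ℝ) ×ˢ (univ : Set X)) :=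
    fun s hs => ⟨hs, mem_univ _⟩
  exact hd.comp_hasDerivWithinAt t h1 h2

lemma hasDerivAt_timeDeriv (hf : ContDiffOn ℝ ∞ f (Ici (0 : ℝ) ×ˢ univ))
    {t : ℝ} (ht : 0 < t) (x : X) :
    HasDerivAt (fun s => f (s, x)) (timeDeriv f (t, x)) t :=
  (hasDerivWithinAt_timeDeriv hf ht.le x).hasDerivAt (Ici_mem_nhds ht)

lemma hasDerivAt_timeDeriv_iteratedDeriv (hf : ContDiffOn ℝ ∞ f (Ici (0 : ℝ) ×ˢ univ))
    {t : ℝ} (ht : 0 < t) (x : X) :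
    HasDerivAt (fun s => timeDeriv f (s, x)) (iteratedDeriv 2 (fun s => f (s, x)) t) t := by
  have h1 := hasDerivAt_timeDeriv (contDiffOn_timeDeriv hf) ht x
  have h2 : deriv (fun s => f (s, x)) =ᶠ[𝓝 t] fun s => timeDeriv f (s, x) := by
    filter_upwards [Ioi_mem_nhds ht] with s hs
    exact (hasDerivAt_timeDeriv hf hs x).deriv
  rw [iteratedDeriv_succ, iteratedDeriv_one, h2.deriv_eq]
  exact h1.differentiableAt.hasDerivAt

end TimeDeriv

lemma eq_of_hasDerivAt_zero_of_continuousOn_Ici {q : ℝ → ℝ} (hq : ContinuousOn q (Ici 0))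
    (h : ∀ s, 0 < s → HasDerivAt q 0 s) {t : ℝ} (ht : 0 < t) : q t = q 0 := by
  obtain ⟨c, -, hc⟩ := exists_hasDerivAt_eq_slope q (fun _ => 0) ht
    (hq.mono Icc_subset_Ici_self) fun s hs => h s hs.1
  have : t - 0 ≠ 0 := by simpa using ht.ne'
  field_simp at hc
  linarith

/-- The system says that $u_t$ minus the elastic operator applied to the primitive has zero time
derivative for $t>0$. This difference is continuous down to $t=0$, where the primitive vanishes, so
it keeps the value $u_1$. -/
lemma timeDeriv_eq_elasticOp {a b : ℝ} {u₀ u₁ : Plane → Plane} {u : ℝ → Plane → Plane}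
    (hu : IsSmoothElasticSolution a b u₀ u₁ u)
    {H : ℝ → Plane → Plane →L[ℝ] Plane →L[ℝ] Plane} {x : Plane} (hHc : Continuous fun s => H s x)
    (hH0 : H 0 x = 0)
    (hH : ∀ t, 0 < t → HasDerivAt (fun s => H s x)
      (spaceDeriv (spaceDeriv fun p : ℝ × Plane => u p.1 p.2) (t, x)) t)
    {t : ℝ} (ht : 0 < t) (k : Fin 2) :
    timeDeriv (fun p : ℝ × Plane => u p.1 p.2) (t, x) k = u₁ x k + elasticOp a b (H t x) k := by
  set U := fun p : ℝ × Plane => u p.1 p.2 with hU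
  have hs := hu.smooth
  have hcoord : ∀ {g : ℝ → Plane} {g' : Plane} {t : ℝ}, HasDerivAt g g' t →
      HasDerivAt (fun s => g s k) (g' k) t := fun h =>
    (EuclideanSpace.proj (𝕜 := ℝ) k).hasFDerivAt.comp_hasDerivAt _ h
  have hq : ContinuousOn (fun s => timeDeriv U (s, x) k - elasticOp a b (H s x) k) (Ici 0) := by
    have h1 : ContinuousOn (fun s : ℝ => timeDeriv U (s, x)) (Ici 0) :=
      (contDiffOn_timeDeriv hs).continuousOn.comp (f := fun s : ℝ => (s, x)) (by fun_prop)
        (fun s hs => ⟨hs, mem_univ _⟩)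
    have h2 : ContinuousOn (fun s : ℝ => timeDeriv U (s, x) k) (Ici 0) :=
      (EuclideanSpace.proj (𝕜 := ℝ) k).continuous.comp_continuousOn h1
    exact h2.sub ((continuous_elasticOp a b k).comp hHc).continuousOn
  have hd : ∀ s, 0 < s →
      HasDerivAt (fun s => timeDeriv U (s, x) k - elasticOp a b (H s x) k) 0 s := by
    intro s hs0
    have h1 := (hcoord (hasDerivAt_timeDeriv_iteratedDeriv hs hs0 x)).sub
      (hasDerivAt_elasticOp a b (hH s hs0) k)
    refine h1.congr_deriv ?_
    have h2 := congrArg (fun z : Plane => z k) (hu.equation s hs0 x)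
    have h3 : ∀ y, HasFDerivAt (u s) (spaceDeriv U (s, y)) y :=
      fun y => hasFDerivAt_spaceDeriv hs hs0.le y
    have h4 : HasFDerivAt (fun y => spaceDeriv U (s, y)) (spaceDeriv (spaceDeriv U) (s, x)) x :=
      hasFDerivAt_spaceDeriv (contDiffOn_spaceDeriv hs) hs0.le x
    rw [laplacian_apply_of_hasFDerivAt h3 h4] at h2
    simp only [PiLp.sub_apply, PiLp.smul_apply, smul_eq_mul, PiLp.zero_apply,
      gradient_divergence_apply h3 h4] at h2
    have h5 : (∑ j, spaceDeriv (spaceDeriv U) (s, x) (basisVec j) (basisVec j)).ofLp k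
        = ∑ j, spaceDeriv (spaceDeriv U) (s, x) (basisVec j) (basisVec j) k := by
      simp
    rw [h5] at h2
    simp only [elasticOp]
    change iteratedDeriv 2 (fun s => u s x) s k - _ = 0
    linarith
  have h0 := eq_of_hasDerivAt_zero_of_continuousOn_Ici hq hd ht
  have h1 : timeDeriv U (0, x) = u₁ x :=
    (uniqueDiffOn_Ici (0 : ℝ) 0 self_mem_Ici).eq_deriv _
      (hasDerivWithinAt_timeDeriv hs le_rfl x) (hu.initial_velocity x)
  have h2 : elasticOp a b (H 0 x) k = 0 := by simp [hH0, elasticOp]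
  simp only [h1, h2] at h0
  linarith

/-- A smooth elastic wave has a potential in the sense of `IsElasticPotential`. -/
lemma IsSmoothElasticSolution.exists_potential {a b : ℝ} {u₀ u₁ : Plane → Plane}
    {u : ℝ → Plane → Plane} (hu : IsSmoothElasticSolution a b u₀ u₁ u) :
    ∃ v w G w' H, IsElasticPotential a b u₀ u₁ v w G w' H ∧ ∀ t, 0 ≤ t → w t = u t := by
  set U := fun p : ℝ × Plane => u p.1 p.2 with hU
  have hs := hu.smooth
  have hs1 := contDiffOn_spaceDeriv hs
  have hs2 := contDiffOn_spaceDeriv hs1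
  set w : ℝ → Plane → Plane := fun t x => U (max t 0, x) with hw
  set w' : ℝ → Plane → Plane →L[ℝ] Plane := fun t x => spaceDeriv U (max t 0, x) with hw'
  set w'' : ℝ → Plane → Plane →L[ℝ] Plane →L[ℝ] Plane :=
    fun t x => spaceDeriv (spaceDeriv U) (max t 0, x) with hw''
  have c0 : Continuous (uncurry w) := continuous_clamp hs
  have c1 : Continuous (uncurry w') := continuous_clamp hs1
  have c2 : Continuous (uncurry w'') := continuous_clamp hs2
  have d0 : ∀ t x, HasFDerivAt (w t) (w' t x) x := spaceDeriv_clamp hs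
  have d1 : ∀ t x, HasFDerivAt (w' t) (w'' t x) x := spaceDeriv_clamp hs1
  have cH := continuous_uncurry_intervalIntegral w'' c2 0
  refine ⟨fun t x => ∫ s in 0..t, w s x, w, fun t x => ∫ s in 0..t, w' s x, w',
    fun t x => ∫ s in 0..t, w'' s x, ⟨continuous_uncurry_intervalIntegral w c0 0, c0,
      continuous_uncurry_intervalIntegral w' c1 0, c1, cH, d0,
      hasFDerivAt_intervalIntegral_of_continuous w w' c0 c1 d0 0,
      hasFDerivAt_intervalIntegral_of_continuous w' w'' c1 c2 d1 0,
      hasDerivAt_intervalIntegral_of_continuous w c0 0,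
      hasDerivAt_intervalIntegral_of_continuous w' c1 0, ?_, fun x => ?_, by simp, by simp⟩,
    fun t ht => ?_⟩
  · intro t ht x k
    rw [← timeDeriv_eq_elasticOp hu (H := fun t x => ∫ s in 0..t, w'' s x)
      (cH.comp (f := fun s : ℝ => (s, x)) (by fun_prop)) (by simp) ?_ ht k]
    · have h1 : HasDerivAt (fun s => u s x) (timeDeriv U (t, x)) t :=
        hasDerivAt_timeDeriv hs ht x
      have h2 : HasDerivAt (fun s => w s x) (timeDeriv U (t, x)) t := by
        refine h1.congr_of_eventuallyEq ?_
        filter_upwards [Ioi_mem_nhds ht] with s hs0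
        simp [hw, hU, max_eq_left (le_of_lt (mem_Ioi.1 hs0))]
      exact (EuclideanSpace.proj (𝕜 := ℝ) k).hasFDerivAt.comp_hasDerivAt _ h2
    · intro s hs0
      have := hasDerivAt_intervalIntegral_of_continuous w'' c2 0 s x
      simpa [hw'', max_eq_left hs0.le] using this
  · simp [hw, hU, hu.initial_value]
  · funext x
    simp [hw, hU, max_eq_left ht]

/-! ### Integrals of functions supported in a fixed compact set. -/

section CompactIntegral

variable {X : Type*} [NormedAddCommGroup X] [NormedSpace ℝ X] [FiniteDimensional ℝ X]
  [MeasurableSpace X] [BorelSpace X] {μ : Measure X} [IsFiniteMeasureOnCompacts μ]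

omit [NormedSpace ℝ X] [FiniteDimensional ℝ X] in
lemma integrable_of_continuous_of_eq_zero {f : X → ℝ} (hf : Continuous f) {K : Set X}
    (hK : IsCompact K) (h : ∀ x ∉ K, f x = 0) : Integrable f μ :=
  hf.integrable_of_hasCompactSupport (HasCompactSupport.intro hK h)

lemma continuousOn_integral_of_eq_zero {h : ℝ → X → ℝ} (hc : Continuous (uncurry h)) {K : Set X}
    (hK : IsCompact K) {I : Set ℝ} (h0 : ∀ t ∈ I, ∀ x ∉ K, h t x = 0) :
    ContinuousOn (fun t => ∫ x, h t x ∂μ) I := by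
  have := continuous_parametric_integral_of_continuous (μ := μ) hc hK
  exact this.continuousOn.congr fun t ht =>
    (setIntegral_eq_integral_of_forall_compl_eq_zero (h0 t ht)).symm

omit [NormedSpace ℝ X] [FiniteDimensional ℝ X] in
lemma hasDerivAt_integral_of_eq_zero {h h' : ℝ → X → ℝ} (hc : Continuous (uncurry h))
    (hc' : Continuous (uncurry h')) {K : Set X} (hK : IsCompact K)
    {T : ℝ} (h0 : ∀ t ∈ Icc 0 T, ∀ x ∉ K, h t x = 0) (h0' : ∀ t ∈ Icc 0 T, ∀ x ∉ K, h' t x = 0)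
    {t : ℝ} (ht : t ∈ Ioo 0 T) (hd : ∀ s, 0 < s → ∀ x, HasDerivAt (fun r => h r x) (h' s x) s) :
    HasDerivAt (fun s => ∫ x, h s x ∂μ) (∫ x, h' t x ∂μ) t := by
  -- The window around `t` stays away from both ends: the pointwise derivative is available only at
  -- positive times, and the support condition only up to `T`.
  obtain ⟨M, hM⟩ := ((isCompact_Icc (a := t / 2) (b := (t + T) / 2)).prod
    hK).exists_bound_of_continuousOn hc'.continuousOn
  have cx : ∀ s, Continuous (h s) := fun s => hc.comp (continuous_const.prodMk continuous_id)
  have cx' : ∀ s, Continuous (h' s) := fun s => hc'.comp (continuous_const.prodMk continuous_id)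
  obtain ⟨ht0, htT⟩ := ht
  have hs : Icc (t / 2) ((t + T) / 2) ∈ 𝓝 t := Icc_mem_nhds (by linarith) (by linarith)
  refine (hasDerivAt_integral_of_dominated_loc_of_deriv_le (bound := K.indicator fun _ => M) hs
    (Eventually.of_forall fun s => (cx s).aestronglyMeasurable)
    (integrable_of_continuous_of_eq_zero (cx t) hK (h0 t ⟨ht0.le, htT.le⟩)) (cx' t).aestronglyMeasurable
    (Eventually.of_forall fun x s hs => ?_) ?_
    (Eventually.of_forall fun x s hs => hd s (by linarith [hs.1]) x)).2
  · by_cases hx : x ∈ K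
    · rw [indicator_of_mem hx]
      exact hM (s, x) ⟨hs, hx⟩
    · rw [indicator_of_notMem hx, h0' s ⟨by linarith [hs.1], by linarith [hs.2]⟩ x hx, norm_zero]
  · exact (integrable_indicator_iff hK.measurableSet).2
      (integrableOn_const hK.measure_lt_top.ne)

omit [IsFiniteMeasureOnCompacts μ] in
lemma integral_lineDeriv_mul_eq_neg [μ.IsAddHaarMeasure] {f g f' g' : X → ℝ} {y : X}
    (hf : ∀ x, HasLineDerivAt ℝ f (f' x) x y) (hg : ∀ x, HasLineDerivAt ℝ g (g' x) x y)
    (cf : Continuous f) (cg : Continuous g) (cf' : Continuous f') (cg' : Continuous g')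
    {K : Set X} (hK : IsCompact K) (h0 : ∀ x ∉ K, g x = 0) (h0' : ∀ x ∉ K, g' x = 0) :
    ∫ x, f' x * g x ∂μ = - ∫ x, f x * g' x ∂μ := by
  have key := integral_bilinear_hasLineDerivAt_right_eq_neg_left_of_integrable (μ := μ)
    (f := f) (g := g) (f' := f') (g' := g') (v := y) (B := ContinuousLinearMap.mul ℝ ℝ)
    (integrable_of_continuous_of_eq_zero (cf'.mul cg) hK fun x hx => by simp [h0 x hx])
    (integrable_of_continuous_of_eq_zero (cf.mul cg') hK fun x hx => by simp [h0' x hx])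
    (integrable_of_continuous_of_eq_zero (cf.mul cg) hK fun x hx => by simp [h0 x hx])
    (fun x _ => hf x) (fun x _ => hg x)
  simp only [ContinuousLinearMap.mul_apply'] at key
  rw [key, neg_neg]

end CompactIntegral

/-! ### Energy density, energy flux and the local energy identity. -/

/-- The energy density of an elastic wave with velocity `p` and displacement gradient `A`. -/
noncomputable def elasticEnergy (a b : ℝ) (p : Plane) (A : Plane →L[ℝ] Plane) : ℝ :=
  (∑ k, p k ^ 2) / 2 + a ^ 2 / 2 * (∑ j, ∑ k, A (basisVec j) k ^ 2)
    + (b ^ 2 - a ^ 2) / 2 * (∑ j, A (basisVec j) j) ^ 2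

/-- The energy flux of an elastic wave with velocity `p` and displacement gradient `A`. -/
noncomputable def elasticFlux (a b : ℝ) (p : Plane) (A : Plane →L[ℝ] Plane) (j : Fin 2) : ℝ :=
  a ^ 2 * (∑ k, A (basisVec j) k * p k) + (b ^ 2 - a ^ 2) * ((∑ i, A (basisVec i) i) * p j)

/-- The divergence of the energy flux, in terms of the derivatives `A'` of `A` and `p'` of `p`. -/
noncomputable def elasticFluxDiv (a b : ℝ) (p : Plane) (A : Plane →L[ℝ] Plane)
    (p' : Plane →L[ℝ] Plane) (A' : Plane →L[ℝ] Plane →L[ℝ] Plane) (j : Fin 2) (y : Plane) : ℝ :=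
  a ^ 2 * (∑ k, (A (basisVec j) k * p' y k + p k * A' y (basisVec j) k))
    + (b ^ 2 - a ^ 2) * ((∑ i, A (basisVec i) i) * p' y j + p j * ∑ i, A' y (basisVec i) i)

/-- This is where `b` enters as the maximal speed. Completing squares in $br\,\partial_jv_k+y_jp_k$
and in $br\operatorname{div}v+y\cdot p$ bounds the flux by the gradient part of the energy plus a
form in $p$. Since $|y\cdot p|\le|y||p|$, the weights $a^2$ and $b^2-a^2$ in that form add up to at
most $b^2r^2|p|^2$. -/
lemma elasticFlux_le {a b r : ℝ} (ha : 0 < a) (hab : a < b) (hr : 0 < r) (p y : Plane)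
    (A : Plane →L[ℝ] Plane) (hy : ‖y‖ ≤ r) :
    -∑ j, elasticFlux a b p A j * y j ≤ b * r * elasticEnergy a b p A := by
  have hy2 : y 0 ^ 2 + y 1 ^ 2 ≤ r ^ 2 := by
    have h1 := EuclideanSpace.norm_sq_eq y
    simp only [Fin.sum_univ_two, Real.norm_eq_abs, sq_abs] at h1
    rw [← h1]
    exact pow_le_pow_left₀ (norm_nonneg _) hy 2
  simp only [elasticFlux, elasticEnergy, Fin.sum_univ_two]
  set p0 := p 0
  set p1 := p 1
  set y0 := y 0
  set y1 := y 1
  set A00 := A (basisVec 0) 0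
  set A01 := A (basisVec 0) 1
  set A10 := A (basisVec 1) 0
  set A11 := A (basisVec 1) 1
  have hb : 0 < b := ha.trans hab
  have hba : 0 ≤ b ^ 2 - a ^ 2 := by nlinarith
  have hbr : 0 < b * r := by positivity
  have q1 : 0 ≤ a ^ 2 * ((b * r * A00 + y0 * p0) ^ 2 + (b * r * A01 + y0 * p1) ^ 2
      + (b * r * A10 + y1 * p0) ^ 2 + (b * r * A11 + y1 * p1) ^ 2)
      + (b ^ 2 - a ^ 2) * (b * r * (A00 + A11) + (y0 * p0 + y1 * p1)) ^ 2 := by positivity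
  have q2 : a ^ 2 * ((y0 ^ 2 + y1 ^ 2) * (p0 ^ 2 + p1 ^ 2))
      + (b ^ 2 - a ^ 2) * (y0 * p0 + y1 * p1) ^ 2 ≤ b ^ 2 * r ^ 2 * (p0 ^ 2 + p1 ^ 2) := by
    have e1 : (y0 * p0 + y1 * p1) ^ 2 ≤ (y0 ^ 2 + y1 ^ 2) * (p0 ^ 2 + p1 ^ 2) := by
      nlinarith [sq_nonneg (y0 * p1 - y1 * p0)]
    have e2 := mul_le_mul_of_nonneg_left e1 hba
    have e3 : (y0 ^ 2 + y1 ^ 2) * (p0 ^ 2 + p1 ^ 2) ≤ r ^ 2 * (p0 ^ 2 + p1 ^ 2) :=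
      mul_le_mul_of_nonneg_right hy2 (by positivity)
    have e4 := mul_le_mul_of_nonneg_left e3 (sq_nonneg b)
    nlinarith
  refine le_of_mul_le_mul_left ?_ hbr
  nlinarith

lemma elasticEnergy_nonneg {a b : ℝ} (ha : 0 < a) (hab : a < b) (p : Plane)
    (A : Plane →L[ℝ] Plane) : 0 ≤ elasticEnergy a b p A := by
  have hba : 0 ≤ b ^ 2 - a ^ 2 := by nlinarith
  unfold elasticEnergy
  positivity

namespace IsElasticPotential

variable {a b : ℝ} {u₀ u₁ : Plane → Plane} {v w : ℝ → Plane → Plane}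
    {G w' : ℝ → Plane → Plane →L[ℝ] Plane}
    {H : ℝ → Plane → Plane →L[ℝ] Plane →L[ℝ] Plane}

lemma hasDerivAt_coord {g : ℝ → Plane} {g' : Plane} {t : ℝ} (h : HasDerivAt g g' t) (k : Fin 2) :
    HasDerivAt (fun s => g s k) (g' k) t :=
  (EuclideanSpace.proj (𝕜 := ℝ) k).hasFDerivAt.comp_hasDerivAt _ h

/-- The equation contributes the power $u_1\cdot w$. As $u_1$ does not depend on time and $v_t=w$,
subtracting $v\cdot u_1$ cancels it exactly and only a divergence remains. -/
lemma hasDerivAt_energy (h : IsElasticPotential a b u₀ u₁ v w G w' H) {t : ℝ} (ht : 0 < t)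
    (x : Plane) :
    HasDerivAt (fun s => elasticEnergy a b (w s x) (G s x) - ∑ k, v s x k * u₁ x k)
      (∑ j, elasticFluxDiv a b (w t x) (G t x) (w' t x) (H t x) j (basisVec j)) t := by
  have hG : ∀ j k, HasDerivAt (fun s => G s x (basisVec j) k) (w' t x (basisVec j) k) t :=
    fun j k => hasDerivAt_coord (by
      simpa using (h.hasDerivAt_G t x).clm_apply (hasDerivAt_const t (basisVec j))) k
  have hw := fun k => h.hasDerivAt_w t ht x k
  have hv := fun k => hasDerivAt_coord (h.hasDerivAt_v t x) k
  unfold elasticEnergy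
  simp only [Fin.sum_univ_two]
  refine HasDerivAt.congr_deriv (((((((hw 0).pow 2).add ((hw 1).pow 2)).div_const 2).add
    (((((hG 0 0).pow 2).add ((hG 0 1).pow 2)).add
      (((hG 1 0).pow 2).add ((hG 1 1).pow 2))).const_mul (a ^ 2 / 2))).add
    ((((hG 0 0).add (hG 1 1)).pow 2).const_mul ((b ^ 2 - a ^ 2) / 2))).sub
    (((hv 0).mul_const (u₁ x 0)).add ((hv 1).mul_const (u₁ x 1)))) ?_
  simp only [elasticFluxDiv, elasticOp, Fin.sum_univ_two, Pi.add_apply]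
  ring

end IsElasticPotential

namespace IsElasticPotential

variable {a b : ℝ} {u₀ u₁ : Plane → Plane} {v w : ℝ → Plane → Plane}
    {G w' : ℝ → Plane → Plane →L[ℝ] Plane}
    {H : ℝ → Plane → Plane →L[ℝ] Plane →L[ℝ] Plane}

/-- The derivative is one-directional: `elasticFluxDiv` becomes a divergence only after putting
$y=e_j$ and summing over `j`. This form is what integration by parts needs. -/
lemma hasLineDerivAt_flux (h : IsElasticPotential a b u₀ u₁ v w G w' H) (t : ℝ) (j : Fin 2)
    (x y : Plane) :
    HasLineDerivAt ℝ (fun x => elasticFlux a b (w t x) (G t x) j)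
      (elasticFluxDiv a b (w t x) (G t x) (w' t x) (H t x) j y) x y := by
  have hG : ∀ j k, HasDerivAt (fun s : ℝ => G t (x + s • y) (basisVec j) k)
      (H t x y (basisVec j) k) 0 := fun j k => hasDerivAt_coord (by
        have h1 : HasDerivAt (fun s : ℝ => G t (x + s • y)) (H t x y) 0 :=
          (h.hasFDerivAt_G t x).hasLineDerivAt y
        simpa using h1.clm_apply (hasDerivAt_const (0 : ℝ) (basisVec j))) k
  have hw : ∀ k, HasDerivAt (fun s : ℝ => w t (x + s • y) k) (w' t x y k) 0 := fun k =>
    hasDerivAt_coord ((h.hasFDerivAt_w t x).hasLineDerivAt y) k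
  unfold elasticFlux HasLineDerivAt
  simp only [Fin.sum_univ_two]
  refine HasDerivAt.congr_deriv (((((hG j 0).mul (hw 0)).add ((hG j 1).mul (hw 1))).const_mul
    (a ^ 2)).add ((((hG 0 0).add (hG 1 1)).mul (hw j)).const_mul (b ^ 2 - a ^ 2))) ?_
  simp only [elasticFluxDiv, Fin.sum_univ_two, zero_smul, add_zero, Pi.add_apply]
  ring

lemma continuous_w_coord (h : IsElasticPotential a b u₀ u₁ v w G w' H) (k : Fin 2) :
    Continuous fun p : ℝ × Plane => w p.1 p.2 k :=
  (EuclideanSpace.proj (𝕜 := ℝ) k).continuous.comp h.continuous_w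

lemma continuous_v_coord (h : IsElasticPotential a b u₀ u₁ v w G w' H) (k : Fin 2) :
    Continuous fun p : ℝ × Plane => v p.1 p.2 k :=
  (EuclideanSpace.proj (𝕜 := ℝ) k).continuous.comp h.continuous_v

lemma continuous_G_coord (h : IsElasticPotential a b u₀ u₁ v w G w' H) (y : Plane) (k : Fin 2) :
    Continuous fun p : ℝ × Plane => G p.1 p.2 y k :=
  (EuclideanSpace.proj (𝕜 := ℝ) k).continuous.comp
    ((ContinuousLinearMap.apply ℝ Plane y).continuous.comp h.continuous_G)

lemma continuous_w'_coord (h : IsElasticPotential a b u₀ u₁ v w G w' H) (y : Plane) (k : Fin 2) :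
    Continuous fun p : ℝ × Plane => w' p.1 p.2 y k :=
  (EuclideanSpace.proj (𝕜 := ℝ) k).continuous.comp
    ((ContinuousLinearMap.apply ℝ Plane y).continuous.comp h.continuous_w')

lemma continuous_H_coord (h : IsElasticPotential a b u₀ u₁ v w G w' H) (y z : Plane) (k : Fin 2) :
    Continuous fun p : ℝ × Plane => H p.1 p.2 y z k :=
  (EuclideanSpace.proj (𝕜 := ℝ) k).continuous.comp
    ((ContinuousLinearMap.apply ℝ Plane z).continuous.comp
      ((ContinuousLinearMap.apply ℝ (Plane →L[ℝ] Plane) y).continuous.comp h.continuous_H))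

lemma continuous_energy (h : IsElasticPotential a b u₀ u₁ v w G w' H) :
    Continuous fun p : ℝ × Plane => elasticEnergy a b (w p.1 p.2) (G p.1 p.2) := by
  have h1 := h.continuous_w_coord
  have h2 := fun j => h.continuous_G_coord (basisVec j)
  unfold elasticEnergy
  exact (((continuous_finsetSum _ fun k _ => (h1 k).pow 2).div_const 2).add
    (continuous_const.mul (continuous_finsetSum _ fun j _ =>
      continuous_finsetSum _ fun k _ => (h2 j k).pow 2))).add
    (continuous_const.mul ((continuous_finsetSum _ fun j _ => h2 j j).pow 2))

lemma continuous_flux (h : IsElasticPotential a b u₀ u₁ v w G w' H) (j : Fin 2) :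
    Continuous fun p : ℝ × Plane => elasticFlux a b (w p.1 p.2) (G p.1 p.2) j := by
  have h1 := h.continuous_w_coord
  have h2 := fun j => h.continuous_G_coord (basisVec j)
  unfold elasticFlux
  exact (continuous_const.mul (continuous_finsetSum _ fun k _ => (h2 j k).mul (h1 k))).add
    (continuous_const.mul ((continuous_finsetSum _ fun i _ => h2 i i).mul (h1 j)))

lemma continuous_fluxDiv (h : IsElasticPotential a b u₀ u₁ v w G w' H) (j : Fin 2) (y : Plane) :
    Continuous fun p : ℝ × Plane =>
      elasticFluxDiv a b (w p.1 p.2) (G p.1 p.2) (w' p.1 p.2) (H p.1 p.2) j y := by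
  have h1 := h.continuous_w_coord
  have h2 := fun j => h.continuous_G_coord (basisVec j)
  have h3 := h.continuous_w'_coord y
  have h4 := fun j => h.continuous_H_coord y (basisVec j)
  unfold elasticFluxDiv
  exact (continuous_const.mul (continuous_finsetSum _ fun k _ =>
      ((h2 j k).mul (h3 k)).add ((h1 k).mul (h4 j k)))).add
    (continuous_const.mul (((continuous_finsetSum _ fun i _ => h2 i i).mul (h3 j)).add
      ((h1 j).mul (continuous_finsetSum _ fun i _ => h4 i i))))

/-- The energy density, corrected by the work of the initial velocity. -/
noncomputable def correctedEnergy (a b : ℝ) (u₁ : Plane → Plane) (v w : ℝ → Plane → Plane)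
    (G : ℝ → Plane → Plane →L[ℝ] Plane) (t : ℝ) (x : Plane) : ℝ :=
  elasticEnergy a b (w t x) (G t x) - ∑ k, v t x k * u₁ x k

lemma continuous_correctedEnergy (h : IsElasticPotential a b u₀ u₁ v w G w' H)
    (hu : Continuous u₁) : Continuous (uncurry (correctedEnergy a b u₁ v w G)) := by
  have h1 := h.continuous_energy
  have h2 := h.continuous_v_coord
  have h3 : ∀ k, Continuous fun p : ℝ × Plane => u₁ p.2 k := fun k =>
    (EuclideanSpace.proj (𝕜 := ℝ) k).continuous.comp (hu.comp continuous_snd)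
  exact h1.sub (continuous_finsetSum _ fun k _ => (h2 k).mul (h3 k))

/-- A `C¹` weight with supports in a fixed compact set `K` during the time interval `[0, T]`. -/
structure IsWeight (T : ℝ) (K : Set Plane) (ψ ψt : ℝ → Plane → ℝ) (ψx : Fin 2 → ℝ → Plane → ℝ) :
    Prop where
  isCompact : IsCompact K
  continuous : Continuous (uncurry ψ)
  continuous_t : Continuous (uncurry ψt)
  continuous_x : ∀ j, Continuous (uncurry (ψx j))
  hasDerivAt : ∀ t x, HasDerivAt (fun s => ψ s x) (ψt t x) t
  hasLineDerivAt : ∀ j t x, HasLineDerivAt ℝ (ψ t) (ψx j t x) x (basisVec j)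
  eq_zero : ∀ t ∈ Icc 0 T, ∀ x ∉ K, ψ t x = 0
  eq_zero_t : ∀ t ∈ Icc 0 T, ∀ x ∉ K, ψt t x = 0
  eq_zero_x : ∀ j, ∀ t ∈ Icc 0 T, ∀ x ∉ K, ψx j t x = 0

variable {T : ℝ} {K : Set Plane} {ψ ψt : ℝ → Plane → ℝ} {ψx : Fin 2 → ℝ → Plane → ℝ}

lemma continuousOn_weightedEnergy (h : IsElasticPotential a b u₀ u₁ v w G w' H)
    (hu : Continuous u₁) (hψ : IsWeight T K ψ ψt ψx) :
    ContinuousOn (fun t => ∫ x, correctedEnergy a b u₁ v w G t x * ψ t x) (Icc 0 T) :=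
  continuousOn_integral_of_eq_zero
    (h := fun t x => correctedEnergy a b u₁ v w G t x * ψ t x)
    ((h.continuous_correctedEnergy hu).mul hψ.continuous) hψ.isCompact
    fun t ht x hx => by simp [hψ.eq_zero t ht x hx]

/-- The local energy identity, integrated against a weight. -/
lemma hasDerivAt_weightedEnergy (h : IsElasticPotential a b u₀ u₁ v w G w' H)
    (hu : Continuous u₁) (hψ : IsWeight T K ψ ψt ψx) {t : ℝ} (ht : t ∈ Ioo 0 T) :
    HasDerivAt (fun s => ∫ x, correctedEnergy a b u₁ v w G s x * ψ s x)
      (∫ x, (correctedEnergy a b u₁ v w G t x * ψt t x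
        - ∑ j, elasticFlux a b (w t x) (G t x) j * ψx j t x)) t := by
  have cE := h.continuous_correctedEnergy hu
  set D : Fin 2 → ℝ → Plane → ℝ := fun j t x =>
    elasticFluxDiv a b (w t x) (G t x) (w' t x) (H t x) j (basisVec j) with hD
  have cD : ∀ j, Continuous (uncurry (D j)) := fun j => h.continuous_fluxDiv j _
  have slice : ∀ {f : ℝ → Plane → ℝ}, Continuous (uncurry f) → Continuous (f t) := fun hf =>
    hf.comp (continuous_const.prodMk continuous_id)
  have h1 := hasDerivAt_integral_of_eq_zero (μ := volume)
    (h := fun t x => correctedEnergy a b u₁ v w G t x * ψ t x)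
    (h' := fun t x => (∑ j, D j t x) * ψ t x + correctedEnergy a b u₁ v w G t x * ψt t x)
    (cE.mul hψ.continuous)
    (((continuous_finsetSum _ fun j _ => cD j).mul hψ.continuous).add (cE.mul hψ.continuous_t))
    hψ.isCompact (fun t ht x hx => by simp [hψ.eq_zero t ht x hx])
    (fun t ht x hx => by simp [hψ.eq_zero t ht x hx, hψ.eq_zero_t t ht x hx]) ht
    (fun s hs x => (h.hasDerivAt_energy hs x).mul (hψ.hasDerivAt s x))
  refine h1.congr_deriv ?_
  replace ht := Ioo_subset_Icc_self ht
  have ibp : ∀ j, ∫ x, D j t x * ψ t x =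
      - ∫ x, elasticFlux a b (w t x) (G t x) j * ψx j t x := fun j =>
    integral_lineDeriv_mul_eq_neg (fun x => h.hasLineDerivAt_flux t j x (basisVec j))
      (hψ.hasLineDerivAt j t) (slice (f := fun t x => elasticFlux a b (w t x) (G t x) j)
        (h.continuous_flux j)) (slice hψ.continuous) (slice (cD j)) (slice (hψ.continuous_x j))
      hψ.isCompact (hψ.eq_zero t ht) (hψ.eq_zero_x j t ht)
  have i1 : Integrable fun x => correctedEnergy a b u₁ v w G t x * ψt t x :=
    integrable_of_continuous_of_eq_zero ((slice cE).mul (slice hψ.continuous_t)) hψ.isCompact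
      fun x hx => by simp [hψ.eq_zero_t t ht x hx]
  have i2 : ∀ j, Integrable fun x => D j t x * ψ t x := fun j =>
    integrable_of_continuous_of_eq_zero ((slice (cD j)).mul (slice hψ.continuous)) hψ.isCompact
      fun x hx => by simp [hψ.eq_zero t ht x hx]
  have i3 : ∀ j, Integrable fun x => elasticFlux a b (w t x) (G t x) j * ψx j t x := fun j =>
    integrable_of_continuous_of_eq_zero ((slice (f := fun t x => elasticFlux a b (w t x) (G t x) j)
        (h.continuous_flux j)).mul (slice (hψ.continuous_x j))) hψ.isCompact
      fun x hx => by simp [hψ.eq_zero_x j t ht x hx]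
  simp only [Finset.sum_mul]
  rw [integral_add (integrable_finsetSum _ fun j _ => i2 j) i1,
    integral_finsetSum _ fun j _ => i2 j,
    integral_sub i1 (integrable_finsetSum _ fun j _ => i3 j), integral_finsetSum _ fun j _ => i3 j]
  simp only [ibp, Finset.sum_neg_distrib]
  ring

end IsElasticPotential

/-! ### Finite speed of propagation by a smooth weight in a backward cone. -/

lemma deriv_expNegInvGlue_nonneg (s : ℝ) : 0 ≤ deriv expNegInvGlue s :=
  expNegInvGlue.monotone.deriv_nonneg

/-- Every nonpositive point is a global minimum, so no one-sided computation at $0$ is needed. -/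
lemma deriv_expNegInvGlue_of_nonpos {s : ℝ} (hs : s ≤ 0) : deriv expNegInvGlue s = 0 := by
  refine IsLocalMin.deriv_eq_zero (Eventually.of_forall fun y => ?_)
  rw [expNegInvGlue.zero_of_nonpos hs]
  exact expNegInvGlue.nonneg y

lemma continuous_deriv_expNegInvGlue : Continuous (deriv expNegInvGlue) :=
  (expNegInvGlue.contDiff (n := 1)).continuous_deriv le_rfl

lemma hasDerivAt_expNegInvGlue (s : ℝ) :
    HasDerivAt expNegInvGlue (deriv expNegInvGlue s) s :=
  ((expNegInvGlue.contDiff (n := 1)).differentiable (by simp) s).hasDerivAt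

lemma hasLineDerivAt_norm_sub_sq (z x : Plane) (j : Fin 2) :
    HasLineDerivAt ℝ (fun x : Plane => ‖x - z‖ ^ 2) (2 * (x j - z j)) x (basisVec j) := by
  have h1 : HasDerivAt (fun s : ℝ => x + s • basisVec j - z) (basisVec j) 0 := by
    simpa using (((hasDerivAt_id (0 : ℝ)).smul_const (basisVec j)).const_add x).sub_const z
  have h2 := h1.norm_sq
  simp only [zero_smul, add_zero, EuclideanSpace.inner_single_right] at h2
  unfold HasLineDerivAt
  simpa using h2

namespace IsElasticPotential

variable {a b : ℝ} {u₀ u₁ : Plane → Plane} {v w : ℝ → Plane → Plane}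
    {G w' : ℝ → Plane → Plane →L[ℝ] Plane}
    {H : ℝ → Plane → Plane →L[ℝ] Plane →L[ℝ] Plane}

/-- A weight supported in the backward cone of speed `b` over the ball of radius `ρ` at `z`. -/
lemma isWeight_cone {ρ : ℝ} (hb : 0 < b) (z : Plane) :
    IsWeight (ρ / b) (Metric.closedBall z ρ)
      (fun t x => expNegInvGlue ((ρ - b * t) ^ 2 - ‖x - z‖ ^ 2))
      (fun t x => deriv expNegInvGlue ((ρ - b * t) ^ 2 - ‖x - z‖ ^ 2) * (-2 * b * (ρ - b * t)))
      (fun j t x => deriv expNegInvGlue ((ρ - b * t) ^ 2 - ‖x - z‖ ^ 2) * (-(2 * (x j - z j)))) := by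
  have neg : ∀ t ∈ Icc 0 (ρ / b), ∀ x ∉ Metric.closedBall z ρ,
      (ρ - b * t) ^ 2 - ‖x - z‖ ^ 2 ≤ 0 := by
    intro t ht x hx
    have h1 : b * t ≤ ρ := by
      have := (le_div_iff₀ hb).1 ht.2
      linarith
    have h2 : ρ < ‖x - z‖ := by simpa [dist_eq_norm] using hx
    have h3 : 0 ≤ b * t := mul_nonneg hb.le ht.1
    nlinarith
  have cσ : Continuous fun p : ℝ × Plane => (ρ - b * p.1) ^ 2 - ‖p.2 - z‖ ^ 2 := by fun_prop
  refine ⟨isCompact_closedBall _ _, (expNegInvGlue.contDiff (n := 0)).continuous.comp cσ,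
    (continuous_deriv_expNegInvGlue.comp cσ).mul (by fun_prop),
    fun j => (continuous_deriv_expNegInvGlue.comp cσ).mul ?_, fun t x => ?_, fun j t x => ?_,
    fun t ht x hx => expNegInvGlue.zero_of_nonpos (neg t ht x hx),
    fun t ht x hx => by rw [deriv_expNegInvGlue_of_nonpos (neg t ht x hx), zero_mul],
    fun j t ht x hx => by rw [deriv_expNegInvGlue_of_nonpos (neg t ht x hx), zero_mul]⟩
  · have : Continuous fun p : ℝ × Plane => p.2 j :=
      (EuclideanSpace.proj (𝕜 := ℝ) j).continuous.comp continuous_snd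
    exact (continuous_const.mul (this.sub continuous_const)).neg
  · have h1 : HasDerivAt (fun s => (ρ - b * s) ^ 2 - ‖x - z‖ ^ 2) (-2 * b * (ρ - b * t)) t := by
      refine ((((hasDerivAt_id t).const_mul b).const_sub ρ).pow 2).sub_const (‖x - z‖ ^ 2)
        |>.congr_deriv ?_
      simp
      ring
    exact (hasDerivAt_expNegInvGlue _).comp t h1
  · have h1 : HasDerivAt (fun s : ℝ => (ρ - b * t) ^ 2 - ‖x + s • basisVec j - z‖ ^ 2)
        (-(2 * (x j - z j))) 0 :=
      HasDerivAt.const_sub ((ρ - b * t) ^ 2) (hasLineDerivAt_norm_sub_sq z x j)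
    have h2 : HasDerivAt expNegInvGlue
        (deriv expNegInvGlue ((ρ - b * t) ^ 2 - ‖x - z‖ ^ 2))
        ((ρ - b * t) ^ 2 - ‖x + (0 : ℝ) • basisVec j - z‖ ^ 2) := by
      simpa using hasDerivAt_expNegInvGlue ((ρ - b * t) ^ 2 - ‖x - z‖ ^ 2)
    exact h2.comp (0 : ℝ) h1

lemma eq_zero_of_elasticEnergy_eq_zero (ha : 0 < a) (hab : a < b) {p : Plane}
    {A : Plane →L[ℝ] Plane} (h : elasticEnergy a b p A = 0) :
    p = 0 ∧ ∀ j k, A (basisVec j) k = 0 := by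
  have hba : 0 < b ^ 2 - a ^ 2 := by nlinarith
  have h1 : 0 ≤ ∑ k, p k ^ 2 := by positivity
  have h2 : 0 ≤ a ^ 2 / 2 * ∑ j, ∑ k, A (basisVec j) k ^ 2 := by positivity
  have h3 : 0 ≤ (b ^ 2 - a ^ 2) / 2 * (∑ j, A (basisVec j) j) ^ 2 := by positivity
  unfold elasticEnergy at h
  have e1 : ∑ k, p k ^ 2 = 0 := by linarith
  have e2 : ∑ j, ∑ k, A (basisVec j) k ^ 2 = 0 := by
    have : a ^ 2 / 2 * ∑ j, ∑ k, A (basisVec j) k ^ 2 = 0 := by linarith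
    have ha2 : a ^ 2 / 2 ≠ 0 := by positivity
    exact (mul_eq_zero.1 this).resolve_left ha2
  constructor
  · ext k
    have := (Finset.sum_eq_zero_iff_of_nonneg fun k _ => sq_nonneg (p k)).1 e1 k (Finset.mem_univ k)
    simpa using this
  · intro j k
    have h4 := (Finset.sum_eq_zero_iff_of_nonneg fun j _ =>
      Finset.sum_nonneg fun k _ => sq_nonneg (A (basisVec j) k)).1 e2 j (Finset.mem_univ j)
    have := (Finset.sum_eq_zero_iff_of_nonneg fun k _ =>
      sq_nonneg (A (basisVec j) k)).1 h4 k (Finset.mem_univ k)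
    simpa using this

/-- Finite speed of propagation. -/
lemma eq_zero_of_lt_norm (h : IsElasticPotential a b u₀ u₁ v w G w' H) (ha : 0 < a) (hab : a < b)
    (hu : Continuous u₁) {L : ℝ} (h₀ : ∀ x, L < ‖x‖ → u₀ x = 0) (h₁ : ∀ x, L < ‖x‖ → u₁ x = 0)
    {t : ℝ} (ht : 0 ≤ t) {z : Plane} (hz : L + b * t < ‖z‖) :
    w t z = 0 ∧ ∀ j k, G t z (basisVec j) k = 0 := by
  have hb : 0 < b := ha.trans hab
  -- The largest radius for which the open base of the cone at `z` misses the ball carrying the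
  -- data.
  set ρ := ‖z‖ - L with hρ
  have htT : t < ρ / b := by
    rw [lt_div_iff₀ hb]
    linarith
  have hψ := isWeight_cone (ρ := ρ) hb z
  set E : ℝ → ℝ := fun s => ∫ x, correctedEnergy a b u₁ v w G s x *
    expNegInvGlue ((ρ - b * s) ^ 2 - ‖x - z‖ ^ 2) with hE
  have hr : ∀ s ∈ Icc 0 (ρ / b), 0 ≤ ρ - b * s := fun s hs => by
    have := (le_div_iff₀ hb).1 hs.2
    linarith
  -- Where the weight is positive the initial data vanish, so the corrected energy is the true,
  -- nonnegative energy there.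
  have far : ∀ s ∈ Icc 0 (ρ / b), ∀ x, 0 < (ρ - b * s) ^ 2 - ‖x - z‖ ^ 2 →
      L < ‖x‖ ∧ ‖x - z‖ < ρ - b * s := by
    intro s hs x hx
    have h1 : ‖x - z‖ < ρ - b * s := lt_of_pow_lt_pow_left₀ 2 (hr s hs) (by linarith)
    have h2 : ‖z‖ ≤ ‖x‖ + ‖x - z‖ := by
      have := norm_sub_le x (x - z)
      simpa using this
    have h3 := mul_nonneg hb.le hs.1
    exact ⟨by linarith, h1⟩
  have corr : ∀ s x, L < ‖x‖ →
      correctedEnergy a b u₁ v w G s x = elasticEnergy a b (w s x) (G s x) := fun s x hx => by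
    simp [correctedEnergy, h₁ x hx]
  have nonneg : ∀ s ∈ Icc 0 (ρ / b), ∀ x, 0 ≤ correctedEnergy a b u₁ v w G s x *
      expNegInvGlue ((ρ - b * s) ^ 2 - ‖x - z‖ ^ 2) := by
    intro s hs x
    rcases le_or_gt ((ρ - b * s) ^ 2 - ‖x - z‖ ^ 2) 0 with hx | hx
    · simp [expNegInvGlue.zero_of_nonpos hx]
    · rw [corr s x (far s hs x hx).1]
      exact mul_nonneg (elasticEnergy_nonneg ha hab _ _) (expNegInvGlue.nonneg _)
  have zero_mem : (0 : ℝ) ∈ Icc 0 (ρ / b) := ⟨le_rfl, ht.trans htT.le⟩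
  have E0 : E 0 = 0 := by
    have key : ∀ x, correctedEnergy a b u₁ v w G 0 x *
        expNegInvGlue ((ρ - b * 0) ^ 2 - ‖x - z‖ ^ 2) = 0 := by
      intro x
      rcases le_or_gt ((ρ - b * 0) ^ 2 - ‖x - z‖ ^ 2) 0 with hx | hx
      · rw [expNegInvGlue.zero_of_nonpos hx, mul_zero]
      · rw [corr 0 x (far 0 zero_mem x hx).1]
        simp [h.w_zero, h.G_zero, h₀ x (far 0 zero_mem x hx).1, elasticEnergy]
    simp only [hE, key, integral_zero]
  have hd : ∀ s ∈ Ioo 0 (ρ / b), HasDerivAt E _ s := fun s hs =>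
    h.hasDerivAt_weightedEnergy hu hψ hs
  have hc : ContinuousOn E (Icc 0 (ρ / b)) := h.continuousOn_weightedEnergy hu hψ
  have anti : AntitoneOn E (Icc 0 (ρ / b)) := by
    refine antitoneOn_of_deriv_nonpos (convex_Icc 0 (ρ / b)) hc ?_ ?_
    · rw [interior_Icc]
      exact fun s hs => (hd s hs).differentiableAt.differentiableWithinAt
    · rw [interior_Icc]
      intro s hs
      rw [(hd s hs).deriv]
      refine integral_nonpos_of_ae (Eventually.of_forall fun x => ?_)
      have hs' := Ioo_subset_Icc_self hs
      rcases le_or_gt ((ρ - b * s) ^ 2 - ‖x - z‖ ^ 2) 0 with hx | hx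
      · simp [deriv_expNegInvGlue_of_nonpos hx]
      · obtain ⟨f1, f2⟩ := far s hs' x hx
        -- The weight shrinks at a rate proportional to $b(\rho-bs)$, and its gradient is
        -- proportional to $z-x$ with $|z-x|<\rho-bs$. The flux bound with `r` equal to $\rho-bs$ is
        -- thus exactly what makes the integrand nonpositive.
        have key := elasticFlux_le ha hab ((norm_nonneg _).trans_lt f2) (w s x) (z - x) (G s x)
          (by rw [norm_sub_rev]; exact f2.le)
        simp only [corr s x f1, Fin.sum_univ_two, PiLp.sub_apply, Pi.zero_apply] at key ⊢
        have := mul_le_mul_of_nonneg_left key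
          (deriv_expNegInvGlue_nonneg ((ρ - b * s) ^ 2 - ‖x - z‖ ^ 2))
        linarith
  have htm : t ∈ Icc 0 (ρ / b) := ⟨ht, htT.le⟩
  have Et : E t = 0 := le_antisymm ((anti zero_mem htm ht).trans_eq E0) (integral_nonneg (nonneg t htm))
  have ct : Continuous fun x => correctedEnergy a b u₁ v w G t x *
      expNegInvGlue ((ρ - b * t) ^ 2 - ‖x - z‖ ^ 2) :=
    ((h.continuous_correctedEnergy hu).comp (f := fun x : Plane => (t, x)) (by fun_prop)).mul
      ((expNegInvGlue.contDiff (n := 0)).continuous.comp (by fun_prop))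
  have hint := integrable_of_continuous_of_eq_zero (μ := volume) ct hψ.isCompact fun x hx => by
    simp [hψ.eq_zero t htm x hx]
  have ae := (integral_eq_zero_iff_of_nonneg (nonneg t htm) hint).1 Et
  -- Continuity turns vanishing almost everywhere into vanishing everywhere, so the product can be
  -- evaluated at the centre `z`, where the weight is positive.
  have hfun := (ct.ae_eq_iff_eq volume continuous_zero).1 ae
  have hz0 : correctedEnergy a b u₁ v w G t z *
      expNegInvGlue ((ρ - b * t) ^ 2 - ‖z - z‖ ^ 2) = 0 := congrFun hfun z
  have hpos : 0 < expNegInvGlue ((ρ - b * t) ^ 2 - ‖z - z‖ ^ 2) := by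
    have h1 : 0 < ρ - b * t := by linarith
    have h2 : 0 < (ρ - b * t) ^ 2 - ‖z - z‖ ^ 2 := by
      rw [sub_self, norm_zero]
      linarith [pow_pos h1 2]
    exact expNegInvGlue.pos_of_pos h2
  have hL : L < ‖z‖ := by
    have := mul_nonneg hb.le ht
    linarith
  have := (mul_eq_zero.1 hz0).resolve_right hpos.ne'
  rw [corr t z hL] at this
  exact eq_zero_of_elasticEnergy_eq_zero ha hab this

/-- A point outside the domain of influence at time `t` was outside it at all earlier times, so
$v_t=w$ vanished there throughout. -/
lemma v_eq_zero_of_lt_norm (h : IsElasticPotential a b u₀ u₁ v w G w' H) (ha : 0 < a)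
    (hab : a < b) (hu : Continuous u₁) {L : ℝ} (h₀ : ∀ x, L < ‖x‖ → u₀ x = 0)
    (h₁ : ∀ x, L < ‖x‖ → u₁ x = 0) {t : ℝ} (ht : 0 ≤ t) {z : Plane} (hz : L + b * t < ‖z‖) :
    v t z = 0 := by
  have hb : 0 < b := ha.trans hab
  rw [← h.v_zero z]
  refine constant_of_has_deriv_right_zero (f := fun s => v s z) (a := 0) (b := t)
    (fun s _ => (h.hasDerivAt_v s z).continuousAt.continuousWithinAt) (fun s hs => ?_) t ⟨ht, le_rfl⟩
  have h1 : L + b * s < ‖z‖ := by nlinarith [hs.2]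
  rw [← (h.eq_zero_of_lt_norm ha hab hu h₀ h₁ hs.1 h1).1]
  exact (h.hasDerivAt_v s z).hasDerivWithinAt

/-! ### Conservation of the corrected energy. -/

/-- Conservation of the corrected energy. -/
lemma integral_correctedEnergy_eq (h : IsElasticPotential a b u₀ u₁ v w G w' H) (ha : 0 < a)
    (hab : a < b) (hu : Continuous u₁) {L : ℝ} (hL : 0 < L) (h₀ : ∀ x, L < ‖x‖ → u₀ x = 0)
    (h₁ : ∀ x, L < ‖x‖ → u₁ x = 0) {t : ℝ} (ht : 0 ≤ t) :
    ∫ x, correctedEnergy a b u₁ v w G t x = ∫ x, correctedEnergy a b u₁ v w G 0 x := by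
  have hb : 0 < b := ha.trans hab
  set T := t + 1 with hT
  have hbT : 0 < b * T := mul_pos hb (by linarith)
  -- A time-independent cutoff, equal to $1$ on a ball that contains the wave at all times before
  -- `T`. Its gradient therefore never meets the flux.
  let χ : ContDiffBump (0 : Plane) := ⟨L + b * T, L + b * T + 1, by linarith, by linarith⟩
  have χ1 : ContDiff ℝ 1 χ := χ.contDiff
  have hχ : IsWeight T (Metric.closedBall 0 (L + b * T + 1)) (fun _ x => χ x) (fun _ _ => 0)
      (fun j _ x => fderiv ℝ χ x (basisVec j)) := by
    refine ⟨isCompact_closedBall _ _, χ.continuous.comp continuous_snd, continuous_const,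
      fun j => ?_, fun t x => hasDerivAt_const _ _,
      fun j t x => (χ1.differentiable (by simp) x).hasFDerivAt.hasLineDerivAt _,
      fun t _ x hx => ?_, fun t _ x hx => rfl, fun j t _ x hx => ?_⟩
    · exact ((χ1.continuous_fderiv (by simp)).comp continuous_snd).clm_apply continuous_const
    · exact χ.zero_of_le_dist (le_of_lt (not_le.1 hx))
    · have h1 : χ =ᶠ[𝓝 x] fun _ => 0 := by
        filter_upwards [Metric.isClosed_closedBall.isOpen_compl.mem_nhds hx] with y hy
        exact χ.zero_of_le_dist (le_of_lt (not_le.1 hy))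
      simp [h1.fderiv_eq]
  have hd : ∀ s ∈ Ioo 0 T,
      HasDerivAt (fun s => ∫ x, correctedEnergy a b u₁ v w G s x * χ x) 0 s := by
    intro s hs
    refine (h.hasDerivAt_weightedEnergy hu hχ hs).congr_deriv ?_
    refine integral_eq_zero_of_ae (Eventually.of_forall fun x => ?_)
    rcases lt_or_ge (L + b * s) ‖x‖ with hx | hx
    · obtain ⟨e1, e2⟩ := h.eq_zero_of_lt_norm ha hab hu h₀ h₁ hs.1.le hx
      simp [elasticFlux, e1]
    · have h1 : χ =ᶠ[𝓝 x] fun _ => 1 := by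
        have : x ∈ Metric.ball (0 : Plane) (L + b * T) := by
          have := mul_lt_mul_of_pos_left hs.2 hb
          simp only [mem_ball_zero_iff]
          linarith
        filter_upwards [Metric.isOpen_ball.mem_nhds this] with y hy
        exact χ.one_of_mem_closedBall (Metric.ball_subset_closedBall hy)
      simp [h1.fderiv_eq]
  -- The cutoff equals $1$ wherever the corrected energy may be nonzero, so it can be dropped.
  have cut : ∀ s ∈ Icc 0 T, ∫ x, correctedEnergy a b u₁ v w G s x * χ x
      = ∫ x, correctedEnergy a b u₁ v w G s x := by
    intro s hs
    congr 1
    funext x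
    have hbs := mul_nonneg hb.le hs.1
    rcases lt_or_ge (L + b * s) ‖x‖ with hx | hx
    · obtain ⟨e1, e2⟩ := h.eq_zero_of_lt_norm ha hab hu h₀ h₁ hs.1 hx
      simp [correctedEnergy, elasticEnergy, e1, e2, h₁ x (by linarith)]
    · have : x ∈ Metric.closedBall (0 : Plane) (L + b * T) := by
        have := mul_le_mul_of_nonneg_left hs.2 hb.le
        simp only [mem_closedBall_zero_iff]
        linarith
      rw [χ.one_of_mem_closedBall this, mul_one]
  rw [← cut t ⟨ht, by linarith⟩, ← cut 0 ⟨le_rfl, by linarith⟩]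
  rcases ht.eq_or_lt with rfl | ht
  · rfl
  · have hc := h.continuousOn_weightedEnergy hu hχ
    obtain ⟨c, -, hc⟩ := exists_hasDerivAt_eq_slope _ (fun _ => 0) ht
      (hc.mono (Icc_subset_Icc_right (by linarith)))
      fun s hs => hd s ⟨hs.1, by linarith [hs.2]⟩
    have : t - 0 ≠ 0 := by simpa using ht.ne'
    field_simp at hc
    linarith

end IsElasticPotential

/-! ### Polar coordinates and the kernel $|z|^{-1}$. -/

section Polar

open scoped ENNReal Real

/-- The unit vector of the plane in direction `θ`. -/
noncomputable def unitDir (θ : ℝ) : Plane :=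
  Complex.orthonormalBasisOneI.repr (Complex.cos θ + Complex.sin θ * Complex.I)

lemma norm_unitDir (θ : ℝ) : ‖unitDir θ‖ = 1 := by
  rw [unitDir, LinearIsometryEquiv.norm_map, ← Complex.exp_mul_I, Complex.norm_exp_ofReal_mul_I]

lemma continuous_unitDir : Continuous unitDir := by
  unfold unitDir
  exact Complex.orthonormalBasisOneI.repr.continuous.comp (by fun_prop)

lemma lintegral_plane_eq_polar {f : Plane → ℝ≥0∞} (hf : Measurable f) :
    ∫⁻ x, f x = ∫⁻ θ in Ioo (-π) π, ∫⁻ r in Ioi (0 : ℝ), ENNReal.ofReal r * f (r • unitDir θ) := by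
  set e := Complex.orthonormalBasisOneI.repr with he
  have h1 : ∫⁻ x, f x = ∫⁻ z : ℂ, f (e z) :=
    (e.measurePreserving.lintegral_comp hf).symm
  have h2 : ∀ p : ℝ × ℝ, e (Complex.polarCoord.symm p) = p.1 • unitDir p.2 := fun p => by
    rw [Complex.polarCoord_symm_apply, unitDir, ← he, ← map_smul]
    simp [mul_add]
  rw [h1, ← Complex.lintegral_comp_polarCoord_symm]
  simp only [h2, smul_eq_mul, polarCoord_target]
  rw [Measure.volume_eq_prod, ← Measure.prod_restrict, lintegral_prod_symm]
  have h3 : Measurable fun p : ℝ × ℝ => p.1 • unitDir p.2 :=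
    (continuous_fst.smul (continuous_unitDir.comp continuous_snd)).measurable
  exact (measurable_fst.ennreal_ofReal.mul (hf.comp h3)).aemeasurable

lemma measurable_ofReal_norm_inv : Measurable fun z : Plane => ENNReal.ofReal ‖z‖⁻¹ :=
  (measurable_inv.comp measurable_norm).ennreal_ofReal

lemma lintegral_norm_inv_ball :
    ∫⁻ z : Plane, (Metric.ball 0 1).indicator (fun z => ENNReal.ofReal ‖z‖⁻¹) z
      = ENNReal.ofReal (2 * π) := by
  rw [lintegral_plane_eq_polar
    (measurable_ofReal_norm_inv.indicator Metric.isOpen_ball.measurableSet)]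
  have h1 : ∀ θ : ℝ, ∫⁻ r in Ioi (0 : ℝ), ENNReal.ofReal r *
      (Metric.ball (0 : Plane) 1).indicator (fun z => ENNReal.ofReal ‖z‖⁻¹) (r • unitDir θ)
        = 1 := by
    intro θ
    have h2 : ∀ r ∈ Ioi (0 : ℝ), ENNReal.ofReal r *
      (Metric.ball (0 : Plane) 1).indicator (fun z => ENNReal.ofReal ‖z‖⁻¹) (r • unitDir θ)
        = (Iio (1 : ℝ)).indicator (fun _ => (1 : ℝ≥0∞)) r := by
      intro r hr
      have hr' : ‖r • unitDir θ‖ = r := by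
        rw [norm_smul, norm_unitDir, mul_one, Real.norm_of_nonneg (le_of_lt hr)]
      by_cases h : r < 1
      · rw [indicator_of_mem (by simpa [hr'] using h), indicator_of_mem (by simpa using h), hr',
          ← ENNReal.ofReal_mul (le_of_lt hr), mul_inv_cancel₀ (ne_of_gt hr), ENNReal.ofReal_one]
      · rw [indicator_of_notMem (by simpa [hr'] using h), indicator_of_notMem (by simpa using h),
          mul_zero]
    rw [setLIntegral_congr_fun measurableSet_Ioi h2, lintegral_indicator measurableSet_Iio,
      Measure.restrict_restrict measurableSet_Iio]
    simp [Iio_inter_Ioi]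
  simp only [h1, lintegral_one, Measure.restrict_apply_univ, Real.volume_Ioo]
  congr 1
  ring

/-- The source of the logarithm: the Jacobian `r` leaves $r^{-1}$ to be integrated from $1$ to `M`.
-/
lemma lintegral_norm_inv_sq_annulus {M : ℝ} (hM : 1 ≤ M) :
    ∫⁻ z : Plane, ({z : Plane | 1 ≤ ‖z‖ ∧ ‖z‖ ≤ M}).indicator
      (fun z => ENNReal.ofReal ‖z‖⁻¹ ^ 2) z = ENNReal.ofReal (2 * π * Real.log M) := by
  have hms : MeasurableSet {z : Plane | 1 ≤ ‖z‖ ∧ ‖z‖ ≤ M} :=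
    (measurableSet_le measurable_const measurable_norm).inter
      (measurableSet_le measurable_norm measurable_const)
  rw [lintegral_plane_eq_polar ((measurable_ofReal_norm_inv.pow_const 2).indicator hms)]
  have h1 : ∀ θ : ℝ, ∫⁻ r in Ioi (0 : ℝ), ENNReal.ofReal r *
      ({z : Plane | 1 ≤ ‖z‖ ∧ ‖z‖ ≤ M}).indicator
        (fun z => ENNReal.ofReal ‖z‖⁻¹ ^ 2) (r • unitDir θ) = ENNReal.ofReal (Real.log M) := by
    intro θ
    have h2 : ∀ r ∈ Ioi (0 : ℝ), ENNReal.ofReal r * ({z : Plane | 1 ≤ ‖z‖ ∧ ‖z‖ ≤ M}).indicator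
        (fun z => ENNReal.ofReal ‖z‖⁻¹ ^ 2) (r • unitDir θ)
        = (Icc 1 M).indicator (fun r => ENNReal.ofReal r⁻¹) r := by
      intro r hr
      have hr0 : 0 < r := hr
      have hr' : ‖r • unitDir θ‖ = r := by
        rw [norm_smul, norm_unitDir, mul_one, Real.norm_of_nonneg hr0.le]
      by_cases h : r ∈ Icc 1 M
      · have h' : r • unitDir θ ∈ {z : Plane | 1 ≤ ‖z‖ ∧ ‖z‖ ≤ M} := by
          simpa only [Set.mem_ofPred_eq, hr', mem_Icc] using h
        rw [indicator_of_mem h', indicator_of_mem h, hr',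
          ← ENNReal.ofReal_pow (inv_nonneg.2 hr0.le), ← ENNReal.ofReal_mul hr0.le]
        congr 1
        field_simp
      · have h' : r • unitDir θ ∉ {z : Plane | 1 ≤ ‖z‖ ∧ ‖z‖ ≤ M} := by
          simpa only [Set.mem_ofPred_eq, hr', mem_Icc] using h
        rw [indicator_of_notMem h', indicator_of_notMem h, mul_zero]
    have hlog : Real.log M = ∫ r in (1 : ℝ)..M, r⁻¹ := by
      rw [integral_inv_of_pos one_pos (by linarith), div_one]
    have hsub : Icc 1 M ⊆ Ioi (0 : ℝ) := fun r hr => zero_lt_one.trans_le hr.1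
    rw [setLIntegral_congr_fun measurableSet_Ioi h2, lintegral_indicator measurableSet_Icc,
      Measure.restrict_restrict measurableSet_Icc, inter_eq_left.2 hsub, hlog,
      intervalIntegral.integral_of_le hM, ← integral_Icc_eq_integral_Ioc,
      ofReal_integral_eq_lintegral_ofReal]
    · refine ContinuousOn.integrableOn_Icc (continuousOn_inv₀.mono fun r hr => ?_)
      exact ne_of_gt (zero_lt_one.trans_le hr.1)
    · filter_upwards [ae_restrict_mem measurableSet_Icc] with r hr
      exact inv_nonneg.2 (zero_le_one.trans hr.1)
  simp only [h1, lintegral_const, Measure.restrict_apply_univ, Real.volume_Ioo]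
  rw [← ENNReal.ofReal_mul (Real.log_nonneg hM)]
  congr 1
  ring

variable {F : Type*} [NormedAddCommGroup F] [NormedSpace ℝ F] [CompleteSpace F]

/-- The fundamental theorem of calculus along the ray from `y`, followed until it has left the
support of `f`. -/
lemma enorm_le_lintegral_ray {f : Plane → F} {f' : Plane → Plane →L[ℝ] F}
    (hf : ∀ x, HasFDerivAt f (f' x) x) (cf' : Continuous f') {R : ℝ}
    (h0 : ∀ x, R < ‖x‖ → f x = 0) (y : Plane) {e : Plane} (he : ‖e‖ = 1) :
    ‖f y‖ₑ ≤ ∫⁻ r in Ioi (0 : ℝ), ‖f' (y + r • e)‖ₑ := by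
  -- The triangle inequality gives $|y+Te|\ge T-|y|=|R|+1>R$, whatever the sign of `R`.
  set T := |R| + ‖y‖ + 1 with hT
  have hT0 : 0 ≤ T := by positivity
  have hTf : f (y + T • e) = 0 := by
    refine h0 _ ?_
    have h1 : ‖T • e‖ ≤ ‖y + T • e‖ + ‖y‖ := by
      have := norm_sub_le (y + T • e) y
      simpa using this
    rw [norm_smul, he, mul_one, Real.norm_of_nonneg hT0] at h1
    have := le_abs_self R
    linarith
  have hd : ∀ r : ℝ, HasDerivAt (fun r : ℝ => f (y + r • e)) (f' (y + r • e) e) r := fun r => by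
    have h1 : HasDerivAt (fun r : ℝ => y + r • e) e r := by
      simpa using ((hasDerivAt_id r).smul_const e).const_add y
    exact (hf _).comp_hasDerivAt r h1
  have c1 : Continuous fun r : ℝ => f' (y + r • e) e :=
    (cf'.comp (by fun_prop)).clm_apply continuous_const
  have ftc := intervalIntegral.integral_eq_sub_of_hasDerivAt (a := 0) (b := T)
    (fun r _ => hd r) (c1.intervalIntegrable _ _)
  rw [hTf, zero_smul, add_zero, zero_sub, intervalIntegral.integral_of_le hT0] at ftc
  rw [← enorm_neg, ← ftc]
  calc ‖∫ r in Ioc 0 T, f' (y + r • e) e‖ₑ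
      ≤ ∫⁻ r in Ioc 0 T, ‖f' (y + r • e) e‖ₑ := enorm_integral_le_lintegral_enorm _
    _ ≤ ∫⁻ r in Ioc 0 T, ‖f' (y + r • e)‖ₑ := by
        refine lintegral_mono fun r => ?_
        rw [← ofReal_norm, ← ofReal_norm]
        exact ENNReal.ofReal_le_ofReal
          (((f' (y + r • e)).le_opNorm e).trans_eq (by rw [he, mul_one]))
    _ ≤ _ := lintegral_mono_set Ioc_subset_Ioi_self

/-- Integrate the ray estimate over all directions. Rewriting $dr\,d\theta$ as $|z|^{-1}dz$ produces
the kernel. -/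
lemma two_pi_mul_enorm_le {f : Plane → F} {f' : Plane → Plane →L[ℝ] F}
    (hf : ∀ x, HasFDerivAt f (f' x) x) (cf' : Continuous f') {R : ℝ}
    (h0 : ∀ x, R < ‖x‖ → f x = 0) (y : Plane) :
    ENNReal.ofReal (2 * π) * ‖f y‖ₑ ≤ ∫⁻ z, ENNReal.ofReal ‖z‖⁻¹ * ‖f' (y + z)‖ₑ := by
  have hm : Measurable fun z => ENNReal.ofReal ‖z‖⁻¹ * ‖f' (y + z)‖ₑ :=
    measurable_ofReal_norm_inv.mul
      (cf'.comp (continuous_const.add continuous_id)).enorm.measurable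
  rw [lintegral_plane_eq_polar hm]
  have h1 : ENNReal.ofReal (2 * π) * ‖f y‖ₑ = ∫⁻ _ in Ioo (-π) π, ‖f y‖ₑ := by
    simp only [lintegral_const, Measure.restrict_apply_univ, Real.volume_Ioo]
    rw [mul_comm]
    congr 2
    ring
  rw [h1]
  refine lintegral_mono fun θ => ?_
  refine (enorm_le_lintegral_ray hf cf' h0 y (norm_unitDir θ)).trans_eq ?_
  refine setLIntegral_congr_fun measurableSet_Ioi fun r hr => ?_
  have hr0 : 0 < r := hr
  rw [norm_smul, norm_unitDir, mul_one, Real.norm_of_nonneg hr0.le, ← mul_assoc,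
    ← ENNReal.ofReal_mul hr0.le, mul_inv_cancel₀ hr0.ne', ENNReal.ofReal_one, one_mul]

end Polar

/-! ### The logarithmic bilinear estimate. -/

section BilinearBound

open scoped ENNReal Real

lemma lintegral_mul_le_eLpNorm_two {X : Type*} [MeasurableSpace X] {μ : Measure X}
    {f g : X → ℝ≥0∞} (hf : AEMeasurable f μ) (hg : AEMeasurable g μ) :
    ∫⁻ x, f x * g x ∂μ ≤ (∫⁻ x, f x ^ 2 ∂μ) ^ (1 / 2 : ℝ) * (∫⁻ x, g x ^ 2 ∂μ) ^ (1 / 2 : ℝ) := by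
  have := ENNReal.lintegral_mul_le_Lp_mul_Lq μ Real.HolderConjugate.two_two hf hg
  simpa only [Pi.mul_apply, ENNReal.rpow_two] using this

lemma eLpNorm_two_eq_lintegral {X E : Type*} [MeasurableSpace X] {μ : Measure X}
    [NormedAddCommGroup E] (f : X → E) :
    eLpNorm f 2 μ = (∫⁻ x, ‖f x‖ₑ ^ 2 ∂μ) ^ (1 / 2 : ℝ) := by
  rw [eLpNorm_eq_lintegral_rpow_enorm_toReal two_ne_zero ENNReal.ofNat_ne_top]
  simp

lemma toReal_eLpNorm_two_sq {X E : Type*} [MeasurableSpace X] {μ : Measure X}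
    [NormedAddCommGroup E] {f : X → E} (hf : MemLp f 2 μ) :
    (eLpNorm f 2 μ).toReal ^ 2 = ∫ x, ‖f x‖ ^ 2 ∂μ := by
  rw [hf.eLpNorm_eq_integral_rpow_norm two_ne_zero ENNReal.ofNat_ne_top, ENNReal.toReal_ofReal
    (by positivity), ← Real.rpow_natCast, ← Real.rpow_mul (by positivity)]
  simp

variable {F : Type*} [NormedAddCommGroup F] [NormedSpace ℝ F] [CompleteSpace F]

/-- A logarithmic replacement for the missing embedding of `Ḣ¹(ℝ²)` into `L^∞`, tested against
an integrable function. -/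
lemma lintegral_enorm_mul_enorm_le {g : Plane → F} (hg : Continuous g) {f : Plane → F}
    {f' : Plane → Plane →L[ℝ] F} (hf : ∀ x, HasFDerivAt f (f' x) x) (cf' : Continuous f')
    {L R : ℝ} (hg0 : ∀ x, L < ‖x‖ → g x = 0) (hf0 : ∀ x, R < ‖x‖ → f x = 0)
    (hM : 1 ≤ L + R) :
    ∫⁻ x, ‖g x‖ₑ * ‖f x‖ₑ ≤ (eLpNorm g 2 volume
      + ENNReal.ofReal √(Real.log (L + R)) * eLpNorm g 1 volume) * eLpNorm f' 2 volume := by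
  have hf0' : ∀ x, R < ‖x‖ → f' x = 0 := fun x hx => by
    have h1 : f =ᶠ[𝓝 x] fun _ => 0 := by
      filter_upwards [(isOpen_lt continuous_const continuous_norm).mem_nhds hx] with y hy
        using hf0 y hy
    exact (hf x).unique ((hasFDerivAt_const 0 x).congr_of_eventuallyEq h1)
  set N := eLpNorm f' 2 volume with hN
  set k : Plane → ℝ≥0∞ := fun z => ENNReal.ofReal ‖z‖⁻¹ with hk
  have mk : Measurable k := measurable_ofReal_norm_inv
  set S := {z : Plane | 1 ≤ ‖z‖ ∧ ‖z‖ ≤ L + R} with hS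
  have mS : MeasurableSet S :=
    (measurableSet_le measurable_const measurable_norm).inter
      (measurableSet_le measurable_norm measurable_const)
  have mB : MeasurableSet (Metric.ball (0 : Plane) 1) := Metric.isOpen_ball.measurableSet
  have mg : Measurable fun y => ‖g y‖ₑ := hg.enorm.measurable
  have mf'2 : Measurable fun p : Plane × Plane => ‖f' (p.1 + p.2)‖ₑ :=
    (cf'.comp continuous_add).enorm.measurable
  have mr : ∀ y, Measurable fun z => ‖f' (y + z)‖ₑ := fun y =>
    (cf'.comp (continuous_const_add y)).enorm.measurable
  have ml : ∀ z, Measurable fun y => ‖f' (y + z)‖ₑ := fun z =>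
    (cf'.comp (continuous_add_const z)).enorm.measurable
  have mBr : ∀ y, Measurable fun z => (Metric.ball 0 1).indicator k z * ‖f' (y + z)‖ₑ :=
    fun y => (mk.indicator mB).mul (mr y)
  have mgl : ∀ z, Measurable fun y => ‖g y‖ₑ * ‖f' (y + z)‖ₑ := fun z => mg.mul (ml z)
  have trans_left : ∀ y, (∫⁻ z, ‖f' (y + z)‖ₑ ^ 2) ^ (1 / 2 : ℝ) = N := fun y => by
    rw [hN, eLpNorm_two_eq_lintegral,
      lintegral_add_left_eq_self (fun z => ‖f' z‖ₑ ^ 2) y]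
  have trans_right : ∀ z, (∫⁻ y, ‖f' (y + z)‖ₑ ^ 2) ^ (1 / 2 : ℝ) = N := fun z => by
    rw [hN, eLpNorm_two_eq_lintegral,
      lintegral_add_right_eq_self (fun z => ‖f' z‖ₑ ^ 2) z]
  -- When `g y` and `f' (y + z)` are both nonzero, $|y|\le L$ and $|y+z|\le R$, so $|z|\le L+R$. The
  -- kernel may be truncated there before it is cut at $|z|=1$.
  have split : ∀ y, ‖g y‖ₑ * ∫⁻ z, k z * ‖f' (y + z)‖ₑ ≤
      ‖g y‖ₑ * (∫⁻ z, (Metric.ball 0 1).indicator k z * ‖f' (y + z)‖ₑ)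
        + ‖g y‖ₑ * ∫⁻ z, S.indicator k z * ‖f' (y + z)‖ₑ := by
    intro y
    rcases lt_or_ge L ‖y‖ with hy | hy
    · simp [hg0 y hy]
    · rw [← mul_add, ← lintegral_add_left (mBr y)]
      gcongr with z
      rw [← add_mul]
      rcases lt_or_ge (L + R) ‖z‖ with hz | hz
      · have : R < ‖y + z‖ := by
          have h1 := norm_sub_le (y + z) y
          rw [add_sub_cancel_left] at h1
          linarith
        have h2 : ‖f' (y + z)‖ₑ = 0 := by
          rw [hf0' _ this, ← ofReal_norm, norm_zero, ENNReal.ofReal_zero]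
        rw [h2, mul_zero, mul_zero]
      · gcongr
        rcases lt_or_ge ‖z‖ 1 with hz1 | hz1
        · rw [indicator_of_mem (by simpa using hz1)]
          exact le_self_add
        · rw [indicator_of_mem (s := S) ⟨hz1, hz⟩]
          exact le_add_self
  have mB2 : Measurable fun p : Plane × Plane =>
      (Metric.ball 0 1).indicator k p.2 * ‖f' (p.1 + p.2)‖ₑ :=
    ((mk.indicator mB).comp measurable_snd).mul mf'2
  have mh : Measurable fun y =>
      ‖g y‖ₑ * ∫⁻ z, (Metric.ball 0 1).indicator k z * ‖f' (y + z)‖ₑ :=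
    mg.mul mB2.lintegral_prod_right'
  -- Near the origin the kernel is integrable but not square integrable. Fubini puts the integral in
  -- `y` inside, and Cauchy–Schwarz there is uniform in `z` by translation invariance.
  have near : ∫⁻ y, ‖g y‖ₑ * (∫⁻ z, (Metric.ball 0 1).indicator k z * ‖f' (y + z)‖ₑ)
      ≤ ENNReal.ofReal (2 * π) * (eLpNorm g 2 volume * N) := by
    calc ∫⁻ y, ‖g y‖ₑ * (∫⁻ z, (Metric.ball 0 1).indicator k z * ‖f' (y + z)‖ₑ)
        = ∫⁻ y, ∫⁻ z, ‖g y‖ₑ * ((Metric.ball 0 1).indicator k z * ‖f' (y + z)‖ₑ) := by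
          refine lintegral_congr fun y => ?_
          rw [lintegral_const_mul _ (mBr y)]
      _ = ∫⁻ z, ∫⁻ y, ‖g y‖ₑ * ((Metric.ball 0 1).indicator k z * ‖f' (y + z)‖ₑ) := by
          refine lintegral_lintegral_swap (Measurable.aemeasurable ?_)
          exact (mg.comp measurable_fst).mul mB2
      _ = ∫⁻ z, (Metric.ball 0 1).indicator k z * ∫⁻ y, ‖g y‖ₑ * ‖f' (y + z)‖ₑ := by
          refine lintegral_congr fun z => ?_
          rw [← lintegral_const_mul _ (mgl z)]
          refine lintegral_congr fun y => ?_
          ring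
      _ ≤ ∫⁻ z, (Metric.ball 0 1).indicator k z * (eLpNorm g 2 volume * N) := by
          refine lintegral_mono fun z => mul_le_mul_right ?_ _
          rw [← trans_right z, eLpNorm_two_eq_lintegral]
          exact lintegral_mul_le_eLpNorm_two mg.aemeasurable
            (ml z).aemeasurable
      _ = _ := by
          rw [lintegral_mul_const _ (mk.indicator mB), lintegral_norm_inv_ball]
  -- Far from the origin the kernel is square integrable, so Cauchy–Schwarz in `z` is uniform in `y`
  -- and leaves the $L^1$ norm of `g`.
  have far : ∫⁻ y, ‖g y‖ₑ * (∫⁻ z, S.indicator k z * ‖f' (y + z)‖ₑ)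
      ≤ eLpNorm g 1 volume * (ENNReal.ofReal (2 * π * Real.log (L + R)) ^ (1 / 2 : ℝ) * N) := by
    calc ∫⁻ y, ‖g y‖ₑ * (∫⁻ z, S.indicator k z * ‖f' (y + z)‖ₑ)
        ≤ ∫⁻ y, ‖g y‖ₑ * (ENNReal.ofReal (2 * π * Real.log (L + R)) ^ (1 / 2 : ℝ) * N) := by
          refine lintegral_mono fun y => mul_le_mul_right ?_ _
          refine (lintegral_mul_le_eLpNorm_two (mk.indicator mS).aemeasurable
            (mr y).aemeasurable).trans_eq ?_
          rw [trans_left y, ← lintegral_norm_inv_sq_annulus hM]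
          congr 2
          refine lintegral_congr fun z => ?_
          by_cases hz : z ∈ S
          · rw [indicator_of_mem hz, indicator_of_mem hz]
          · rw [indicator_of_notMem hz, indicator_of_notMem hz, zero_pow two_ne_zero]
      _ = _ := by
          rw [lintegral_mul_const _ mg, eLpNorm_one_eq_lintegral_enorm]
  have hπ : 1 ≤ 2 * π := by linarith [Real.pi_gt_three]
  -- Since $\sqrt{2\pi}\le2\pi$, both pieces carry the factor $2\pi$, which cancels against the left
  -- side of the ray estimate.
  have hlog : ENNReal.ofReal (2 * π * Real.log (L + R)) ^ (1 / 2 : ℝ)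
      ≤ ENNReal.ofReal (2 * π) * ENNReal.ofReal √(Real.log (L + R)) := by
    have h1 := Real.log_nonneg hM
    rw [ENNReal.ofReal_rpow_of_nonneg (by positivity) (by norm_num), ← Real.sqrt_eq_rpow,
      ← ENNReal.ofReal_mul (by positivity), Real.sqrt_mul (by positivity)]
    refine ENNReal.ofReal_le_ofReal (mul_le_mul_of_nonneg_right ?_ (Real.sqrt_nonneg _))
    exact Real.sqrt_le_iff.2 ⟨by positivity, by nlinarith⟩
  have h2π : ENNReal.ofReal (2 * π) ≠ 0 := by
    simp only [ne_eq, ENNReal.ofReal_eq_zero, not_le]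
    positivity
  rw [← ENNReal.mul_le_mul_iff_right h2π ENNReal.ofReal_ne_top]
  have cf : Continuous f := continuous_iff_continuousAt.2 fun x => (hf x).continuousAt
  calc ENNReal.ofReal (2 * π) * ∫⁻ x, ‖g x‖ₑ * ‖f x‖ₑ
      = ∫⁻ x, ‖g x‖ₑ * (ENNReal.ofReal (2 * π) * ‖f x‖ₑ) := by
        have mgf : Measurable fun x => ‖g x‖ₑ * ‖f x‖ₑ := mg.mul cf.enorm.measurable
        rw [← lintegral_const_mul _ mgf]
        refine lintegral_congr fun x => ?_
        ring
    _ ≤ ∫⁻ x, ‖g x‖ₑ * ∫⁻ z, k z * ‖f' (x + z)‖ₑ :=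
        lintegral_mono fun x => mul_le_mul_right (two_pi_mul_enorm_le hf cf' hf0 x) _
    _ ≤ ∫⁻ y, (‖g y‖ₑ * (∫⁻ z, (Metric.ball 0 1).indicator k z * ‖f' (y + z)‖ₑ)
        + ‖g y‖ₑ * ∫⁻ z, S.indicator k z * ‖f' (y + z)‖ₑ) := lintegral_mono split
    _ = (∫⁻ y, ‖g y‖ₑ * (∫⁻ z, (Metric.ball 0 1).indicator k z * ‖f' (y + z)‖ₑ))
        + ∫⁻ y, ‖g y‖ₑ * ∫⁻ z, S.indicator k z * ‖f' (y + z)‖ₑ := lintegral_add_left mh _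
    _ ≤ _ := add_le_add near far
    _ ≤ ENNReal.ofReal (2 * π) * (eLpNorm g 2 volume * N) + eLpNorm g 1 volume *
        (ENNReal.ofReal (2 * π) * ENNReal.ofReal √(Real.log (L + R)) * N) := by gcongr
    _ = _ := by ring

end BilinearBound

/-! ### Comparison of norms. -/

section Norms

open scoped ENNReal

lemma memLp_of_continuous_of_eq_zero {E : Type*} [NormedAddCommGroup E] {f : Plane → E}
    (hf : Continuous f) {R : ℝ} (h : ∀ x, R < ‖x‖ → f x = 0) (p : ℝ≥0∞) : MemLp f p volume := by
  refine hf.memLp_of_hasCompactSupport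
    (HasCompactSupport.intro (isCompact_closedBall (0 : Plane) R) fun x hx => h x ?_)
  simpa using hx

lemma toReal_eLpNorm_two_sq_le {f : Plane → Plane} (h1 : MemLp f 1 volume)
    (h2 : MemLp f 2 volume) (ht : MemLp f ⊤ volume) :
    (eLpNorm f 2 volume).toReal ^ 2
      ≤ (eLpNorm f ⊤ volume).toReal * (eLpNorm f 1 volume).toReal := by
  set c := (eLpNorm f ⊤ volume).toReal with hc
  have hi : Integrable f := memLp_one_iff_integrable.1 h1
  have e1 : (eLpNorm f 1 volume).toReal = ∫ x, ‖f x‖ := by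
    rw [eLpNorm_one_eq_lintegral_enorm, integral_norm_eq_lintegral_enorm h1.1]
  rw [toReal_eLpNorm_two_sq h2, e1, ← integral_const_mul]
  refine integral_mono_ae ((memLp_two_iff_integrable_sq_norm h2.1).1 h2) (hi.norm.const_mul c) ?_
  have hb : ∀ᵐ x, ‖f x‖ₑ ≤ eLpNorm f ⊤ volume := by
    rw [eLpNorm_exponent_top]
    exact ae_le_eLpNormEssSup
  filter_upwards [hb] with x hx
  have : ‖f x‖ ≤ c := by
    rw [← toReal_enorm]
    exact ENNReal.toReal_mono ht.2.ne hx
  rw [pow_two]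
  exact mul_le_mul_of_nonneg_right this (norm_nonneg _)

/-- The operator norm is at most the Hilbert–Schmidt norm. The bilinear estimate uses the former,
the energy contains the latter. -/
lemma opNorm_sq_le (A : Plane →L[ℝ] Plane) : ‖A‖ ^ 2 ≤ ∑ j, ∑ k, A (basisVec j) k ^ 2 := by
  have h0 : 0 ≤ ∑ j, ∑ k, A (basisVec j) k ^ 2 := by positivity
  have h1 : ‖A‖ ≤ √(∑ j, ∑ k, A (basisVec j) k ^ 2) := by
    refine A.opNorm_le_bound (Real.sqrt_nonneg _) fun y => ?_
    refine abs_le_of_sq_le_sq' ?_ (by positivity) |>.2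
    rw [mul_pow, Real.sq_sqrt h0, EuclideanSpace.norm_sq_eq, EuclideanSpace.norm_sq_eq]
    have hy : y = y 0 • basisVec 0 + y 1 • basisVec 1 := by
      ext i
      fin_cases i <;> simp
    have hA : ∀ k, A y k = y 0 * A (basisVec 0) k + y 1 * A (basisVec 1) k := fun k => by
      conv_lhs => rw [hy]
      simp
    simp only [Fin.sum_univ_two, Real.norm_eq_abs, sq_abs, hA]
    nlinarith [sq_nonneg (y 0 * A (basisVec 1) 0 - y 1 * A (basisVec 0) 0),
      sq_nonneg (y 0 * A (basisVec 1) 1 - y 1 * A (basisVec 0) 1)]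
  calc ‖A‖ ^ 2 ≤ √(∑ j, ∑ k, A (basisVec j) k ^ 2) ^ 2 :=
        pow_le_pow_left₀ (norm_nonneg _) h1 2
    _ = _ := Real.sq_sqrt h0

lemma clm_eq_zero_of_basisVec {A : Plane →L[ℝ] Plane} (h : ∀ j k, A (basisVec j) k = 0) :
    A = 0 := by
  have := opNorm_sq_le A
  simp only [h] at this
  have h1 : ‖A‖ ^ 2 ≤ 0 := by simpa using this
  exact norm_eq_zero.1 (pow_eq_zero_iff two_ne_zero |>.1 (le_antisymm h1 (sq_nonneg _)))

end Norms

/-! ### The energy inequality and the logarithmic bound. -/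

namespace IsElasticPotential

variable {a b : ℝ} {u₀ u₁ : Plane → Plane} {v w : ℝ → Plane → Plane}
    {G w' : ℝ → Plane → Plane →L[ℝ] Plane}
    {H : ℝ → Plane → Plane →L[ℝ] Plane →L[ℝ] Plane}

lemma memLp_w (h : IsElasticPotential a b u₀ u₁ v w G w' H) (ha : 0 < a) (hab : a < b)
    (hu : Continuous u₁) {L : ℝ} (h₀ : ∀ x, L < ‖x‖ → u₀ x = 0) (h₁ : ∀ x, L < ‖x‖ → u₁ x = 0)
    {t : ℝ} (ht : 0 ≤ t) : MemLp (w t) 2 volume :=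
  memLp_of_continuous_of_eq_zero
    (continuous_iff_continuousAt.2 fun x => (h.hasFDerivAt_w t x).continuousAt)
    (fun _ hx => (h.eq_zero_of_lt_norm ha hab hu h₀ h₁ ht hx).1) 2

/-- Conservation of the corrected energy, whose initial value is $\frac12\|u_0\|_2^2$. The
divergence term is nonnegative because $a<b$ and is discarded. -/
lemma energy_inequality (h : IsElasticPotential a b u₀ u₁ v w G w' H) (ha : 0 < a)
    (hab : a < b) (hu : Continuous u₁) {L : ℝ} (hL : 0 < L)
    (h₀ : ∀ x, L < ‖x‖ → u₀ x = 0) (h₁ : ∀ x, L < ‖x‖ → u₁ x = 0) {t : ℝ} (ht : 0 ≤ t) :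
    (∫ x, ‖w t x‖ ^ 2) / 2 + a ^ 2 / 2 * ∫ x, ‖G t x‖ ^ 2
      ≤ (∫ x, ‖u₀ x‖ ^ 2) / 2 + ∫ x, ‖u₁ x‖ * ‖v t x‖ := by
  have hba : 0 ≤ b ^ 2 - a ^ 2 := by nlinarith
  have hsupp := fun x (hx : L + b * t < ‖x‖) => h.eq_zero_of_lt_norm ha hab hu h₀ h₁ ht hx
  have cw : Continuous (w t) :=
    continuous_iff_continuousAt.2 fun x => (h.hasFDerivAt_w t x).continuousAt
  have cv : Continuous (v t) :=
    continuous_iff_continuousAt.2 fun x => (h.hasFDerivAt_v t x).continuousAt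
  have cG : Continuous (G t) :=
    continuous_iff_continuousAt.2 fun x => (h.hasFDerivAt_G t x).continuousAt
  have integrable_of : ∀ {f : Plane → ℝ} {R : ℝ}, Continuous f → (∀ x, R < ‖x‖ → f x = 0) →
      Integrable f := fun {f R} hf hR =>
    memLp_one_iff_integrable.1 (memLp_of_continuous_of_eq_zero hf hR 1)
  have i1 : Integrable fun x => ‖w t x‖ ^ 2 :=
    integrable_of (R := L + b * t) (cw.norm.pow 2) fun x hx => by simp [(hsupp x hx).1]
  have i2 : Integrable fun x => ‖G t x‖ ^ 2 :=
    integrable_of (R := L + b * t) (cG.norm.pow 2) fun x hx => by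
      simp [clm_eq_zero_of_basisVec (hsupp x hx).2]
  have i3 : Integrable fun x => ‖u₁ x‖ * ‖v t x‖ :=
    integrable_of (R := L) (hu.norm.mul cv.norm) fun x hx => by simp [h₁ x hx]
  have i4 : Integrable fun x => correctedEnergy a b u₁ v w G t x := by
    refine integrable_of (R := max L (L + b * t)) ((h.continuous_correctedEnergy hu).comp
      (f := fun x : Plane => (t, x)) (by fun_prop)) fun x hx => ?_
    obtain ⟨hx1, hx2⟩ := max_lt_iff.1 hx
    simp [correctedEnergy, elasticEnergy, hsupp x hx2, h₁ x hx1]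
  have e0 : ∫ x, correctedEnergy a b u₁ v w G 0 x = (∫ x, ‖u₀ x‖ ^ 2) / 2 := by
    rw [← integral_div]
    refine integral_congr_ae (Eventually.of_forall fun x => ?_)
    simp [correctedEnergy, elasticEnergy, h.w_zero, h.v_zero, h.G_zero, EuclideanSpace.norm_sq_eq]
  rw [← e0, ← h.integral_correctedEnergy_eq ha hab hu hL h₀ h₁ ht, ← integral_div,
    ← integral_const_mul, ← integral_add (i1.div_const 2) (i2.const_mul _), ← integral_add i4 i3]
  refine integral_mono ((i1.div_const 2).add (i2.const_mul _)) (i4.add i3) fun x => ?_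
  have h1 : ∑ k, v t x k * u₁ x k ≤ ‖u₁ x‖ * ‖v t x‖ := by
    have := real_inner_le_norm (u₁ x) (v t x)
    simpa [PiLp.inner_apply] using this
  have h2 := mul_le_mul_of_nonneg_left (opNorm_sq_le (G t x)) (by positivity : 0 ≤ a ^ 2 / 2)
  have h3 : ‖w t x‖ ^ 2 = ∑ k, w t x k ^ 2 := by simp [EuclideanSpace.norm_sq_eq]
  have h4 : 0 ≤ (b ^ 2 - a ^ 2) / 2 * (∑ j, G t x (basisVec j) j) ^ 2 := by positivity
  simp only [correctedEnergy, elasticEnergy]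
  linarith

lemma integral_norm_mul_norm_le (h : IsElasticPotential a b u₀ u₁ v w G w' H) (ha : 0 < a)
    (hab : a < b) (hu : Continuous u₁) {L : ℝ}
    (h₀ : ∀ x, L < ‖x‖ → u₀ x = 0) (h₁ : ∀ x, L < ‖x‖ → u₁ x = 0) {t : ℝ} (ht : 0 ≤ t)
    (hM : 1 ≤ 2 * L + b * t) :
    ∫ x, ‖u₁ x‖ * ‖v t x‖ ≤ ((eLpNorm u₁ 2 volume).toReal
      + √(Real.log (2 * L + b * t)) * (eLpNorm u₁ 1 volume).toReal)
        * (eLpNorm (G t) 2 volume).toReal := by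
  have hsupp := fun x (hx : L + b * t < ‖x‖) => h.eq_zero_of_lt_norm ha hab hu h₀ h₁ ht hx
  have cv : Continuous (v t) :=
    continuous_iff_continuousAt.2 fun x => (h.hasFDerivAt_v t x).continuousAt
  have cG : Continuous (G t) :=
    continuous_iff_continuousAt.2 fun x => (h.hasFDerivAt_G t x).continuousAt
  have key := lintegral_enorm_mul_enorm_le hu (h.hasFDerivAt_v t) cG h₁
    (fun x hx => h.v_eq_zero_of_lt_norm ha hab hu h₀ h₁ ht hx) (by linarith)
  rw [show L + (L + b * t) = 2 * L + b * t by ring] at key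
  have n1 := (memLp_of_continuous_of_eq_zero hu h₁ 1).2.ne
  have n2 := (memLp_of_continuous_of_eq_zero hu h₁ 2).2.ne
  have n3 := (memLp_of_continuous_of_eq_zero cG
    (fun x hx => clm_eq_zero_of_basisVec (hsupp x hx).2) 2).2.ne
  have n4 := ENNReal.mul_ne_top (ENNReal.ofReal_ne_top (r := √(Real.log (2 * L + b * t)))) n1
  have h2 := ENNReal.toReal_mono (ENNReal.mul_ne_top (ENNReal.add_ne_top.2 ⟨n2, n4⟩) n3) key
  rw [ENNReal.toReal_mul, ENNReal.toReal_add n2 n4, ENNReal.toReal_mul,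
    ENNReal.toReal_ofReal (Real.sqrt_nonneg _)] at h2
  refine le_trans (le_of_eq ?_) h2
  rw [integral_eq_lintegral_of_nonneg_ae
    (Eventually.of_forall fun x => mul_nonneg (norm_nonneg _) (norm_nonneg _))
    (hu.norm.mul cv.norm).aestronglyMeasurable]
  congr 1
  refine lintegral_congr fun x => ?_
  rw [ENNReal.ofReal_mul (norm_nonneg _), ofReal_norm, ofReal_norm]

/-- The logarithmic bound for the `L²` norm of an elastic wave. -/
lemma integral_norm_sq_le (h : IsElasticPotential a b u₀ u₁ v w G w' H) (ha : 0 < a)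
    (hab : a < b) (hu0 : Continuous u₀) (hu : Continuous u₁) {L : ℝ} (hL : 0 < L)
    (h₀ : ∀ x, L < ‖x‖ → u₀ x = 0) (h₁ : ∀ x, L < ‖x‖ → u₁ x = 0) {t : ℝ} (ht : 3 / b ≤ t) :
    ∫ x, ‖w t x‖ ^ 2 ≤ (1 + 3 / a ^ 2) * ((eLpNorm u₀ 2 volume).toReal ^ 2
      + (eLpNorm u₁ ⊤ volume).toReal ^ 2
      + (eLpNorm u₁ 1 volume).toReal ^ 2 * Real.log (2 * L + b * t)) := by
  have hb : 0 < b := ha.trans hab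
  have ht0 : 0 ≤ t := le_trans (by positivity) ht
  have hbt : 3 ≤ b * t := by
    have := (div_le_iff₀ hb).1 ht
    linarith
  -- The threshold $3/b$ is chosen so that $bt\ge3>e$. The logarithm is then at least $1$ and can
  -- dominate terms that carry none.
  have hlog : 1 ≤ Real.log (2 * L + b * t) := by
    rw [Real.le_log_iff_exp_le (by linarith)]
    linarith [Real.exp_one_lt_d9]
  have cG : Continuous (G t) :=
    continuous_iff_continuousAt.2 fun x => (h.hasFDerivAt_G t x).continuousAt
  have mG := memLp_of_continuous_of_eq_zero cG (fun x hx => clm_eq_zero_of_basisVec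
    (h.eq_zero_of_lt_norm ha hab hu h₀ h₁ ht0 hx).2) 2
  have e1 := h.energy_inequality ha hab hu hL h₀ h₁ ht0
  have e2 := h.integral_norm_mul_norm_le ha hab hu h₀ h₁ ht0 (by linarith)
  have e3 := toReal_eLpNorm_two_sq_le (memLp_of_continuous_of_eq_zero hu h₁ 1)
    (memLp_of_continuous_of_eq_zero hu h₁ 2) (memLp_of_continuous_of_eq_zero hu h₁ ⊤)
  rw [← toReal_eLpNorm_two_sq mG,
    ← toReal_eLpNorm_two_sq (memLp_of_continuous_of_eq_zero hu0 h₀ 2)] at e1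
  have s1 : √(Real.log (2 * L + b * t)) ^ 2 = Real.log (2 * L + b * t) :=
    Real.sq_sqrt (by linarith)
  set ℓ := Real.log (2 * L + b * t)
  set s := √ℓ
  set A := (eLpNorm u₁ 2 volume).toReal
  set B := (eLpNorm u₁ 1 volume).toReal
  set c := (eLpNorm u₁ ⊤ volume).toReal
  set N := (eLpNorm (G t) 2 volume).toReal
  set D := (eLpNorm u₀ 2 volume).toReal
  have ha2 : 0 < a ^ 2 := by positivity
  -- Young's inequality weighted so that the gradient term is exactly the $\frac{a^2}{2}N^2$ of the
  -- energy inequality, where it cancels.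
  have amgm : (A + s * B) * N ≤ a ^ 2 / 2 * N ^ 2 + (A + s * B) ^ 2 / (2 * a ^ 2) := by
    have h1 : a ^ 2 / 2 * N ^ 2 + (A + s * B) ^ 2 / (2 * a ^ 2) - (A + s * B) * N
        = (a ^ 2 * N - (A + s * B)) ^ 2 / (2 * a ^ 2) := by
      field_simp
      ring
    have h2 : 0 ≤ (a ^ 2 * N - (A + s * B)) ^ 2 / (2 * a ^ 2) := by positivity
    linarith
  -- The $3$ is $2+1$: two copies of $B^2\ell$ from squaring the sum, and one from $2A^2\le2cB\le
  -- c^2+B^2$ with $\ell\ge1$.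
  have hsq : (A + s * B) ^ 2 ≤ c ^ 2 + 3 * (B ^ 2 * ℓ) := by
    have h1 : (A + s * B) ^ 2 ≤ 2 * A ^ 2 + 2 * (s ^ 2 * B ^ 2) := by
      nlinarith [sq_nonneg (A - s * B)]
    have h2 : 2 * (c * B) ≤ c ^ 2 + B ^ 2 := by nlinarith [sq_nonneg (c - B)]
    have h3 : B ^ 2 ≤ B ^ 2 * ℓ := le_mul_of_one_le_right (sq_nonneg B) hlog
    rw [s1] at h1
    linarith
  have hdiv : (A + s * B) ^ 2 / (2 * a ^ 2) ≤ (c ^ 2 + 3 * (B ^ 2 * ℓ)) / (2 * a ^ 2) := by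
    gcongr
  have hB : 0 ≤ B ^ 2 * ℓ := by positivity
  -- Doubling the energy inequality gives the left side. The $1$ in the constant serves $D^2$, and
  -- $3/a^2$ covers the larger of the other two coefficients.
  have hfin : D ^ 2 + (c ^ 2 + 3 * (B ^ 2 * ℓ)) / a ^ 2
      ≤ (1 + 3 / a ^ 2) * (D ^ 2 + c ^ 2 + B ^ 2 * ℓ) := by
    have h1 : (1 + 3 / a ^ 2) * (D ^ 2 + c ^ 2 + B ^ 2 * ℓ)
        - (D ^ 2 + (c ^ 2 + 3 * (B ^ 2 * ℓ)) / a ^ 2)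
        = c ^ 2 + B ^ 2 * ℓ + (3 * D ^ 2 + 2 * c ^ 2) / a ^ 2 := by
      field_simp
      ring
    have h2 : 0 ≤ (3 * D ^ 2 + 2 * c ^ 2) / a ^ 2 := by positivity
    nlinarith [sq_nonneg c]
  have hhalf : (c ^ 2 + 3 * (B ^ 2 * ℓ)) / (2 * a ^ 2)
      = (c ^ 2 + 3 * (B ^ 2 * ℓ)) / a ^ 2 / 2 := by
    field_simp
  linarith

end IsElasticPotential

/-! ### Conclusion. -/

lemma isBigO_log_of_eventually_le {f : ℝ → ℝ} (hf : ∀ t, 0 ≤ f t) {p q L b t₀ : ℝ}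
    (hp : 0 ≤ p) (hq : 0 ≤ q) (hL : 0 < L) (hb : 0 < b)
    (h : ∀ t, t₀ ≤ t → f t ≤ p + q * Real.log (2 * L + b * t)) :
    f =O[atTop] Real.log := by
  refine IsBigO.of_bound (p + 2 * q) ?_
  filter_upwards [eventually_ge_atTop t₀, eventually_ge_atTop (2 * L + b),
    eventually_ge_atTop (Real.exp 1)] with t h1 h2 h3
  have ht : 1 < t := lt_of_lt_of_le (by linarith [Real.add_one_lt_exp one_ne_zero]) h3
  have hl : 1 ≤ Real.log t := (Real.le_log_iff_exp_le (by linarith)).2 h3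
  -- For $t\ge1$ and $t\ge2L+b$ one has $2L+bt\le(2L+b)t\le t^2$, hence the factor $2$.
  have hle : Real.log (2 * L + b * t) ≤ 2 * Real.log t := by
    have h4 : 2 * Real.log t = Real.log (t ^ 2) := by simp
    rw [h4]
    refine Real.log_le_log (by positivity) ?_
    nlinarith
  rw [Real.norm_of_nonneg (hf t), Real.norm_of_nonneg (by linarith)]
  have h5 := mul_le_mul_of_nonneg_left hle hq
  have h6 := le_mul_of_one_le_right hp hl
  linarith [h t h1]

theorem theorem1p2 (a b : ℝ) (ha : 0 < a) (hab : a < b) :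
    ∃ C : ℝ, 0 < C ∧ ∃ t₀ : ℝ, 0 < t₀ ∧
      ∀ L : ℝ, 0 < L →
      ∀ u₀ u₁ : Plane → Plane, ContDiff ℝ ∞ u₀ → ContDiff ℝ ∞ u₁ →
        tsupport u₀ ∪ tsupport u₁ ⊆ {x : Plane | ‖x‖ ≤ L} →
      ∀ u : ℝ → Plane → Plane, IsSmoothElasticSolution a b u₀ u₁ u →
        (∀ t : ℝ, t₀ ≤ t →
          MemLp (u t) 2 volume ∧
          ∫ x : Plane, ‖u t x‖ ^ 2 ≤
            C * ((eLpNorm u₀ 2 volume).toReal ^ 2 + (eLpNorm u₁ ⊤ volume).toReal ^ 2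
              + (eLpNorm u₁ 1 volume).toReal ^ 2 * Real.log (2 * L + b * t))) ∧
        (fun t : ℝ => ∫ x : Plane, ‖u t x‖ ^ 2) =O[atTop] (fun t : ℝ => Real.log t) := by
  have hb : 0 < b := ha.trans hab
  refine ⟨1 + 3 / a ^ 2, by positivity, 3 / b, by positivity, ?_⟩
  intro L hL u₀ u₁ hu₀ hu₁ hsupp u hu
  have h₀ : ∀ x, L < ‖x‖ → u₀ x = 0 := fun x hx =>
    image_eq_zero_of_notMem_tsupport fun h => not_le.2 hx (hsupp (Or.inl h))
  have h₁ : ∀ x, L < ‖x‖ → u₁ x = 0 := fun x hx =>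
    image_eq_zero_of_notMem_tsupport fun h => not_le.2 hx (hsupp (Or.inr h))
  obtain ⟨v, w, G, w', H, h, hw⟩ := hu.exists_potential
  have bound : ∀ t : ℝ, 3 / b ≤ t → MemLp (u t) 2 volume ∧ ∫ x : Plane, ‖u t x‖ ^ 2 ≤
      (1 + 3 / a ^ 2) * ((eLpNorm u₀ 2 volume).toReal ^ 2 + (eLpNorm u₁ ⊤ volume).toReal ^ 2
        + (eLpNorm u₁ 1 volume).toReal ^ 2 * Real.log (2 * L + b * t)) := by
    intro t ht
    have ht0 : 0 ≤ t := le_trans (by positivity) ht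
    rw [← hw t ht0]
    exact ⟨h.memLp_w ha hab hu₁.continuous h₀ h₁ ht0,
      h.integral_norm_sq_le ha hab hu₀.continuous hu₁.continuous hL h₀ h₁ ht⟩
  refine ⟨bound, isBigO_log_of_eventually_le (t₀ := 3 / b)
    (p := (1 + 3 / a ^ 2) * ((eLpNorm u₀ 2 volume).toReal ^ 2
      + (eLpNorm u₁ ⊤ volume).toReal ^ 2))
    (q := (1 + 3 / a ^ 2) * (eLpNorm u₁ 1 volume).toReal ^ 2)
    (fun t => integral_nonneg fun x => by positivity) (by positivity) (by positivity) hL hb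
    fun t ht => (bound t ht).2.trans_eq (by ring)⟩
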